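/- Let $k\ge 0$ be a real number, let $\delta_k(x)=|2\sin x|^{2k}$, and put $$(f,g)_k=\frac1{2\pi}\int_0^{2\pi} f(x)\,\overline{g(x)}\,\delta_k(x)\,dx,\qquad \|f\|_k=\sqrt{(f,f)_k}.$$ For $j,n\in\mathbb Z$ write $j\triangleleft n$ if either $|j|<|n|$ and $|n|-|j|$ is even, or $|j|=|n|$ and $n<j$. For $n\in\mathbb Z$ let $E_n^k$ be the non-symmetric Heckman–Opdam polynomial of type $A_1$, i.e. the unique function of the form $E_n^k(z)=e^{nz}+\sum_{j\triangleleft n}c_{n,j}e^{jz}$ such that $(E_n^k(i\,\cdot),e^{ij\,\cdot})_k=0$ for every $j\triangleleft n$, and let $\mathcal E_n^k=E_n^k/\|E_n^k(i\,\cdot)\|_k$. Define the Riesz kernel $$\mathcal R(n,m)=\frac1{2\pi i}\int_0^{2\pi}e^{-ix/2}\,\mathcal E_m^k(ix)\,\mathcal E_n^k(-ix)\,\delta_k(x)\,dx,\qquad n,m\in\mathbb Z.$$ **Theorem.** For every $k\ge 0$ there is a constant $C>0$, depending only on $k$, such that for all $n,m,\ell\in\mathbb Z$ with $$\frac{|n|}2\le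 |m|\le\frac{3|n|}2,\qquad \frac{|n|}2\le|\ell|\le\frac{3|n|}2,\qquad \big||n|-|m|\big|\ge 2|m-\ell|,$$ one has $$|\mathcal R(n,\ell)-\mathcal R(n,m)|\le C\,\frac{|\ell-m|}{\big||m|-|n|\big|^2}\qquad\text{and}\qquad |\mathcal R(\ell,n)-\mathcal R(m,n)|\le C\,\frac{|\ell-m|}{\big||m|-|n|\big|^2}.$$ (If $|m|=|n|$ the hypotheses force $\ell=m$, and the right-hand sides are read as $0$.) -/

import Mathlib

open scoped NNReal

namespace HeckmanOpdam

noncomputable section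

/-- The weight `δ_k(x) = |2 sin x|^{2k}`. -/
def weight (k : ℝ≥0) (x : ℝ) : ℝ := |2 * Real.sin x| ^ (2 * (k : ℝ))

/-- The inner product `(f, g)_k = (1 / 2π) ∫_0^{2π} f(x) conj(g(x)) δ_k(x) dx`. -/
def ip (k : ℝ≥0) (f g : ℝ → ℂ) : ℂ :=
  (1 / (2 * (Real.pi : ℂ))) *
    ∫ x in (0 : ℝ)..(2 * Real.pi), f x * (starRingEnd ℂ) (g x) * (weight k x : ℂ)

/-- The norm `‖f‖_k = √(f, f)_k`. -/
def ipNorm (k : ℝ≥0) (f : ℝ → ℂ) : ℝ := Real.sqrt (ip k f f).re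

/-- Restriction of a function of a complex variable to the imaginary axis: `x ↦ f(ix)`. -/
def onCircle (f : ℂ → ℂ) (x : ℝ) : ℂ := f (Complex.I * (x : ℂ))

/-- The exponential `z ↦ e^{jz}`. -/
def expFun (j : ℤ) (z : ℂ) : ℂ := Complex.exp ((j : ℂ) * z)

/-- The partial order `j ◁ n` on `ℤ`: either `|j| < |n|` and `|n| - |j|` is even, or
`|j| = |n|` and `n < j`. -/
def Below (j n : ℤ) : Prop := (|j| < |n| ∧ Even (|n| - |j|)) ∨ (|j| = |n| ∧ n < j)

/-- The space of exponential polynomials `∑_{j ◁ n} c_j e^{jz}`. -/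
def lowerSpan (n : ℤ) : Submodule ℂ (ℂ → ℂ) := Submodule.span ℂ (expFun '' {j | Below j n})

/-- The conditions that define the non-symmetric Heckman-Opdam polynomial of type `A₁`:
`E(z) = e^{nz} + ∑_{j ◁ n} c_j e^{jz}`, and `(E(i·), e^{ij·})_k = 0` for every `j ◁ n`. -/
structure IsHeckmanOpdam (k : ℝ≥0) (n : ℤ) (E : ℂ → ℂ) : Prop where
  lead : E - expFun n ∈ lowerSpan n
  orth : ∀ j : ℤ, Below j n → ip k (onCircle E) (onCircle (expFun j)) = 0

/-! ### Existence and uniqueness -/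

/-- The space of entire functions, in which existence and uniqueness are checked. -/
def entire : Submodule ℂ (ℂ → ℂ) where
  carrier := {f | Differentiable ℂ f}
  add_mem' := fun hf hg => Differentiable.add hf hg
  zero_mem' := differentiable_const 0
  smul_mem' := fun c _ hf => Differentiable.const_smul hf c

theorem expFun_mem_entire (j : ℤ) : expFun j ∈ entire := by
  change Differentiable ℂ (fun z : ℂ => Complex.exp ((j : ℂ) * z))
  fun_prop

theorem continuous_weight (k : ℝ≥0) : Continuous (weight k) := by
  unfold weight
  exact Continuous.rpow_const (by fun_prop) (fun _ => Or.inr (by positivity))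

theorem weight_nonneg (k : ℝ≥0) (x : ℝ) : 0 ≤ weight k x := by
  unfold weight
  positivity

theorem continuous_onCircle {f : ℂ → ℂ} (hf : f ∈ entire) : Continuous (onCircle f) := by
  have h : Continuous f := Differentiable.continuous hf
  unfold onCircle
  fun_prop

theorem ip_self (k : ℝ≥0) (f : ℝ → ℂ) :
    ip k f f = ((1 / (2 * Real.pi) *
      ∫ x in (0 : ℝ)..(2 * Real.pi), ‖f x‖ ^ 2 * weight k x : ℝ) : ℂ) := by
  unfold ip
  simp only [Complex.mul_conj, Complex.normSq_eq_norm_sq]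
  push_cast
  rw [← intervalIntegral.integral_ofReal]
  push_cast
  rfl

theorem ip_conj (k : ℝ≥0) (f g : ℝ → ℂ) : (starRingEnd ℂ) (ip k f g) = ip k g f := by
  unfold ip
  rw [map_mul, intervalIntegral.intervalIntegral_eq_integral_uIoc,
    intervalIntegral.intervalIntegral_eq_integral_uIoc]
  simp only [Complex.real_smul, map_mul, Complex.conj_ofReal, ← integral_conj, Complex.conj_conj]
  congr 1
  · simp only [map_div₀, map_one, map_mul, Complex.conj_ofReal, map_ofNat]
  · congr 1
    congr 1
    ext x
    ring

theorem ip_add_left (k : ℝ≥0) {f g h : ℝ → ℂ} (hf : Continuous f) (hg : Continuous g)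
    (hh : Continuous h) : ip k (f + g) h = ip k f h + ip k g h := by
  have hw := continuous_weight k
  unfold ip
  rw [← mul_add, ← intervalIntegral.integral_add]
  · simp only [Pi.add_apply, add_mul]
  · exact Continuous.intervalIntegrable (by fun_prop) _ _
  · exact Continuous.intervalIntegrable (by fun_prop) _ _

theorem ip_smul_left (k : ℝ≥0) (c : ℂ) (f h : ℝ → ℂ) : ip k (c • f) h = c * ip k f h := by
  unfold ip
  simp only [Pi.smul_apply, smul_eq_mul, mul_assoc]
  rw [intervalIntegral.integral_const_mul, mul_left_comm]

/-- The inner product is definite on entire functions. -/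
theorem eq_zero_of_ip_self (k : ℝ≥0) {f : ℂ → ℂ} (hf : f ∈ entire)
    (h : ip k (onCircle f) (onCircle f) = 0) : f = 0 := by
  have hpi := Real.pi_pos
  have hc := continuous_onCircle hf
  have hw := continuous_weight k
  rw [ip_self] at h
  have h1 : ∫ x in (0 : ℝ)..(2 * Real.pi), ‖onCircle f x‖ ^ 2 * weight k x = 0 := by
    have := Complex.ofReal_eq_zero.mp h
    rcases mul_eq_zero.mp this with h2 | h2
    · have : (0 : ℝ) < 1 / (2 * Real.pi) := by positivity
      exact absurd h2 this.ne'
    · exact h2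
  have h2 : ∀ x ∈ Set.Ioo (0 : ℝ) Real.pi, onCircle f x = 0 := by
    intro x hx
    by_contra hne
    have hpos : 0 < ∫ x in (0 : ℝ)..(2 * Real.pi), ‖onCircle f x‖ ^ 2 * weight k x := by
      refine intervalIntegral.integral_pos (by positivity)
        (Continuous.continuousOn (by fun_prop)) ?_ ⟨x, ⟨hx.1.le, by linarith [hx.2]⟩, ?_⟩
      · intro y _
        have := weight_nonneg k y
        positivity
      · have hs := Real.sin_pos_of_pos_of_lt_pi hx.1 hx.2
        have : 0 < weight k x := by
          unfold weight
          exact Real.rpow_pos_of_pos (by positivity) _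
        have : 0 < ‖onCircle f x‖ := norm_pos_iff.mpr hne
        positivity
    exact hpos.ne' h1
  have hd : Differentiable ℂ f := hf
  have han : AnalyticOnNhd ℂ f Set.univ := fun z _ => hd.analyticAt z
  have hmem : Set.Ioo (0 : ℝ) Real.pi ∈ nhds (Real.pi / 2) :=
    Ioo_mem_nhds (by positivity) (by linarith)
  have hev : ∀ᶠ x : ℝ in nhdsWithin (Real.pi / 2) {Real.pi / 2}ᶜ,
      f (Complex.I * (x : ℂ)) = 0 := by
    filter_upwards [mem_nhdsWithin_of_mem_nhds hmem] with x hx using h2 x hx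
  have ht : Filter.Tendsto (fun x : ℝ => Complex.I * (x : ℂ))
      (nhdsWithin (Real.pi / 2) {Real.pi / 2}ᶜ)
      (nhdsWithin (Complex.I * ((Real.pi / 2 : ℝ) : ℂ)) {Complex.I * ((Real.pi / 2 : ℝ) : ℂ)}ᶜ) := by
    refine tendsto_nhdsWithin_iff.mpr ⟨?_, ?_⟩
    · exact (Continuous.tendsto (by fun_prop) _).mono_left nhdsWithin_le_nhds
    · filter_upwards [self_mem_nhdsWithin] with x hx
      simp only [Set.mem_compl_iff, Set.mem_singleton_iff] at hx ⊢
      intro he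
      exact hx (Complex.ofReal_injective (mul_left_cancel₀ Complex.I_ne_zero he))
  have hfr := ht.frequently (p := fun z => f z = 0) hev.frequently
  have hz := han.eqOn_zero_of_preconnected_of_frequently_eq_zero isPreconnected_univ
    (Set.mem_univ _) hfr
  funext z
  exact hz (Set.mem_univ z)

/-- The inner product on entire functions, in the Mathlib convention (linear on the right). -/
@[reducible] def entireCore (k : ℝ≥0) : InnerProductSpace.Core ℂ entire where
  inner f g := ip k (onCircle g.1) (onCircle f.1)
  conj_inner_symm f g := ip_conj k _ _
  re_inner_nonneg f := by
    rw [ip_self]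
    have : 0 ≤ ∫ x in (0 : ℝ)..(2 * Real.pi), ‖onCircle f.1 x‖ ^ 2 * weight k x :=
      intervalIntegral.integral_nonneg (by have := Real.pi_pos; positivity) fun x _ =>
        mul_nonneg (by positivity) (weight_nonneg k x)
    have hp := Real.pi_pos
    rw [RCLike.ofReal_eq_complex_ofReal.symm]
    simp
    positivity
  add_left f g h := by
    rw [← ip_conj, ← ip_conj k (onCircle f.1), ← ip_conj k (onCircle g.1), ← map_add]
    congr 1
    exact ip_add_left k (continuous_onCircle f.2) (continuous_onCircle g.2)
      (continuous_onCircle h.2)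
  smul_left f g c := by
    rw [← ip_conj, ← ip_conj k (onCircle f.1), ← map_mul]
    congr 1
    exact ip_smul_left k c _ _
  definite f hf := Subtype.ext (eq_zero_of_ip_self k f.2 hf)

theorem finite_below (n : ℤ) : {j | Below j n}.Finite := by
  refine (Set.finite_Icc (-|n|) |n|).subset ?_
  intro j hj
  have : |j| ≤ |n| := hj.elim (fun h => h.1.le) (fun h => h.1.le)
  exact abs_le.mp this

theorem lowerSpan_le (n : ℤ) : lowerSpan n ≤ entire := by
  unfold lowerSpan
  rw [Submodule.span_le]
  rintro _ ⟨j, _, rfl⟩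
  exact expFun_mem_entire j

theorem existsUnique_isHeckmanOpdam (k : ℝ≥0) (n : ℤ) : ∃! E : ℂ → ℂ, IsHeckmanOpdam k n E := by
  let := (entireCore k).toNormedAddCommGroup
  let : InnerProductSpace ℂ entire := InnerProductSpace.ofCore (entireCore k).toCore
  let V : Submodule ℂ entire := (lowerSpan n).comap entire.subtype
  have : FiniteDimensional ℂ (lowerSpan n) :=
    FiniteDimensional.span_of_finite ℂ ((finite_below n).image _)
  have : FiniteDimensional ℂ V :=
    FiniteDimensional.of_injective
      ((entire.subtype.domRestrict V).codRestrict (lowerSpan n) fun v => v.2)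
      (fun a b h => Subtype.ext (Subtype.ext (congrArg (fun t : lowerSpan n => t.1) h)))
  have hdef : ∀ f g : entire, inner ℂ f g = ip k (onCircle g.1) (onCircle f.1) := fun _ _ => rfl
  let e : ℤ → entire := fun j => ⟨expFun j, expFun_mem_entire j⟩
  have he : ∀ j, Below j n → e j ∈ V := fun j hj =>
    Submodule.subset_span (Set.mem_image_of_mem _ hj)
  refine ⟨(e n - V.starProjection (e n) : entire).1, ⟨?_, ?_⟩, ?_⟩
  · have h := V.starProjection_apply_mem (e n)
    have h2 : (V.starProjection (e n)).1 ∈ lowerSpan n := h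
    have h3 := (lowerSpan n).neg_mem h2
    convert h3 using 1
    change (expFun n - (V.starProjection (e n)).1) - expFun n = _
    abel
  · intro j hj
    have h := V.sub_starProjection_mem_orthogonal (e n)
    exact (hdef (e j) _).symm.trans ((Submodule.mem_orthogonal V _).mp h _ (he j hj))
  · intro F hF
    have hFe : F ∈ entire := by
      have := entire.add_mem (lowerSpan_le n hF.lead) (expFun_mem_entire n)
      simpa using this
    have hE := V.sub_starProjection_mem_orthogonal (e n)
    have h2 : (V.starProjection (e n)).1 ∈ lowerSpan n := V.starProjection_apply_mem (e n)
    let d : entire := ⟨F, hFe⟩ - (e n - V.starProjection (e n))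
    have hdV : d ∈ V := by
      change F - (expFun n - (V.starProjection (e n)).1) ∈ lowerSpan n
      have := (lowerSpan n).add_mem hF.lead h2
      convert this using 1
      abel
    have hFo : (⟨F, hFe⟩ : entire) ∈ Vᗮ := by
      rw [Submodule.mem_orthogonal']
      rintro ⟨u, hu⟩ huV
      change u ∈ lowerSpan n at huV
      have key : ∀ u (hu : u ∈ lowerSpan n),
          inner ℂ (⟨F, hFe⟩ : entire) (⟨u, lowerSpan_le n hu⟩ : entire) = 0 := by
        intro u hu
        unfold lowerSpan at hu
        induction hu using Submodule.span_induction with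
        | mem x hx =>
          obtain ⟨j, hj, rfl⟩ := hx
          rw [hdef, ← ip_conj, hF.orth j hj, map_zero]
        | zero => exact inner_zero_right _
        | add x y hx hy h1 h2 =>
          exact (inner_add_right (𝕜 := ℂ) (⟨F, hFe⟩ : entire) ⟨x, lowerSpan_le n hx⟩
            ⟨y, lowerSpan_le n hy⟩).trans (by rw [h1, h2, add_zero])
        | smul c x hx h1 =>
          exact (inner_smul_right (𝕜 := ℂ) (⟨F, hFe⟩ : entire) ⟨x, lowerSpan_le n hx⟩ c).trans
            (by rw [h1, mul_zero])
      exact key u huV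
    have hdo : d ∈ Vᗮ := Vᗮ.sub_mem hFo hE
    have hd0 : d = 0 := by
      have := (Submodule.mem_orthogonal V d).mp hdo d hdV
      exact inner_self_eq_zero.mp this
    exact congrArg Subtype.val (sub_eq_zero.mp hd0)

/-! ### The polynomials and the Riesz kernel -/

/-- The non-symmetric Heckman-Opdam polynomial `E_n^k` of type `A₁`. -/
def opdamPoly (k : ℝ≥0) (n : ℤ) : ℂ → ℂ := (existsUnique_isHeckmanOpdam k n).choose

theorem opdamPoly_spec (k : ℝ≥0) (n : ℤ) : IsHeckmanOpdam k n (opdamPoly k n) :=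
  (existsUnique_isHeckmanOpdam k n).choose_spec.1

/-- The normalized polynomial `ℰ_n^k = E_n^k / ‖E_n^k‖_k`, the norm being that of `E_n^k(i·)`. -/
def normOpdamPoly (k : ℝ≥0) (n : ℤ) (z : ℂ) : ℂ :=
  opdamPoly k n z / (ipNorm k (onCircle (opdamPoly k n)) : ℂ)

/-- The Riesz kernel
`ℛ(n, m) = (1 / 2πi) ∫_0^{2π} e^{-ix/2} ℰ_m^k(ix) ℰ_n^k(-ix) δ_k(x) dx`. -/
def rieszKernel (k : ℝ≥0) (n m : ℤ) : ℂ :=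
  (1 / (2 * (Real.pi : ℂ) * Complex.I)) *
    ∫ x in (0 : ℝ)..(2 * Real.pi),
      Complex.exp (-(Complex.I * (x : ℂ) / 2)) * normOpdamPoly k m (Complex.I * (x : ℂ)) *
        normOpdamPoly k n (-(Complex.I * (x : ℂ))) * (weight k x : ℂ)

end

end HeckmanOpdam

/-!
The polynomials are found explicitly. The weight depends on `w = e^{2ix}` only, so that `E_n` is,
up to a power of `e^{ix}`, an orthogonal polynomial on the unit circle for the weight
`|1 - w|^{2k}` or its reversal. Szegő's recursion, with the coefficients `β_p = k / (p + k)`,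
therefore defines functions `G_p` with `E_{-p}(z) = G_p(z)` and `E_{p+1}(z) = e^z G_p(-z)`. By
induction they are eigenfunctions of the Cherednik operator, with eigenvalue `n + k` for `n > 0`
and `n - k` for `n ≤ 0`. On `[0, π]` this eigenvalue equation is a real first-order system for the
real and imaginary parts (`isHalfSol_half`), and it gives orthogonality
(`IsHalfSol.integral_eq_zero`), hence `opdamPoly_eq_explicitPoly`.

Two uniform bounds are needed for `F_n = (2 sin x)^k ℰ_n(ix)` on `[0, π]`. First, `|F_n| ≤ C`
(`exists_norm_circleFun_le`). For `p sin x ≲ 1` it follows from the growth of order `p^k` of the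
normalized `G_p`, which the recursion gives at once; for larger `p` it follows from the quadratic
form `|z|² + 2 β_p Re(z² / (e^{2ix} - 1))`, which Szegő's recursion preserves up to the change of
the norm and of `β_p` (`energy_step`). Second, `|F_{n+1} - F_n| ≤ C (sin (x / 2) + 1 / |n|)` for
`n` and `n + 1` of the same sign (`exists_norm_circleFun_sub_le`), which is read off from the
recursion.

By the reflection `x ↦ 2π - x` the kernel is an integral over `[0, π]`,
`π ℛ(n, m) = ∫ Im (e^{-ix/2} F_m conj F_n)`. Write `a` and `b` for the eigenvalues of `E_m` and
`E_n`. The real and imaginary parts of `F_m conj F_n` and of `e^{-ix} F_m F_n` satisfy a closed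
system of differential equations, which allows three integrations by parts on `[ε, π]`
(`integral_kernelIntegrand`, `integral_twistRe`, `integral_twistIm`). The first gains `a - b` and
costs a factor `1 / sin (x / 2)`; each of the other two gains `a + b - 1` at the same cost. With
`ε = 1 / |n|` the uniform bounds yield, for the difference of the kernel at `m` and `m + 1`, the
bound `C (1 / N² + N / (S² D) + N / (S D²))`, where `N = |n|` and `S`, `D` are lower bounds for
`|a + b - 1|` and `|a - b|` (`PairBound.integral_kernelIntegrand_sub_le`). Of `S` and `D`, one is
of order `|n|` and the other of order `||n| - |m||` (`exists_gaps`), and so the difference is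
`O(1 / (|n| - |m|)²)`. Summation over the integers between `m` and `l` finishes the proof. The cut
at `ε` makes the argument uniform in `k ≥ 0`, since no singular integral has to converge at `0`.
-/

namespace HeckmanOpdam

noncomputable section

/-! ### Explicit polynomials and the eigenvalue equation -/

/-- The polynomial `G_p = E_{-p}`, given by Szegő's recursion
`G_{p+1}(z) = e^{-z} G_p(z) + k / (p + 1 + k) · e^z G_p(-z)`. With `w = e^{2ix}`, `e^{ipx} G_p(ix)`
is the reversed orthogonal polynomial of degree `p` in `w` for the weight `|1 - w|^{2k}` on the
unit circle, and `k / (p + 1 + k)` is, up to sign, its Verblunsky coefficient. -/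
def szego (k : ℝ) : ℕ → ℂ → ℂ
  | 0, _ => 1
  | p + 1, z => Complex.exp (-z) * szego k p z +
    ((k / (p + 1 + k) : ℝ) : ℂ) * (Complex.exp z * szego k p (-z))

theorem szego_conj (k : ℝ) (p : ℕ) (z : ℂ) :
    (starRingEnd ℂ) (szego k p z) = szego k p ((starRingEnd ℂ) z) := by
  induction p generalizing z with
  | zero => simp [szego]
  | succ p ih => simp [szego, ih, ← Complex.exp_conj]

theorem differentiable_szego (k : ℝ) (p : ℕ) : Differentiable ℂ (szego k p) := by
  induction p with
  | zero => exact differentiable_const 1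
  | succ p ih =>
    have h2 : Differentiable ℂ (fun z : ℂ => szego k p (-z)) := ih.comp differentiable_neg
    change Differentiable ℂ (fun z : ℂ => Complex.exp (-z) * szego k p z +
      ((k / (p + 1 + k) : ℝ) : ℂ) * (Complex.exp z * szego k p (-z)))
    fun_prop

theorem hasDerivAt_cexp_I_mul (x : ℝ) :
    HasDerivAt (fun x : ℝ => Complex.exp (Complex.I * x))
      (Complex.exp (Complex.I * x) * Complex.I) x := by
  have : HasDerivAt (fun x : ℝ => Complex.I * (x : ℂ)) (Complex.I * 1) x :=
    Complex.ofRealCLM.hasDerivAt.const_mul Complex.I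
  simpa using this.cexp

theorem sin_eq_cexp_I_mul (x : ℂ) :
    Complex.sin x =
      ((Complex.exp (Complex.I * x))⁻¹ - Complex.exp (Complex.I * x)) * Complex.I / 2 := by
  rw [Complex.sin, ← Complex.exp_neg]
  congr 4 <;> ring_nf

/-- On the circle `G_p` is an eigenfunction of the Cherednik operator with eigenvalue `-(p + k)`;
the eigenvalue equation is solved here for the derivative. -/
theorem hasDerivAt_szego {k : ℝ} (hk : 0 ≤ k) (p : ℕ) {x : ℝ} (hx : Real.sin x ≠ 0) :
    HasDerivAt (fun x : ℝ => szego k p (Complex.I * x))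
      (-(Complex.I * p * szego k p (Complex.I * x)) -
        k * Complex.exp (Complex.I * x) *
          (szego k p (Complex.I * x) - szego k p (-(Complex.I * x))) / Real.sin x) x := by
  induction p generalizing x with
  | zero =>
    have : (fun x : ℝ => szego k 0 (Complex.I * x)) = fun _ => (1 : ℂ) := by
      funext x; simp [szego]
    rw [this]
    simpa [szego] using hasDerivAt_const x (1 : ℂ)
  | succ p ih =>
    have h1 := ih hx
    have hx' : Real.sin (-x) ≠ 0 := by simpa using hx
    have h2 := ((ih hx').scomp x (hasDerivAt_neg x))
    simp only [Function.comp_def, Complex.ofReal_neg, mul_neg, neg_neg, Real.sin_neg] at h2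
    have e1 : HasDerivAt (fun x : ℝ => Complex.exp (-(Complex.I * x)))
        (Complex.exp (-(Complex.I * x)) * (-Complex.I)) x := by
      have : HasDerivAt (fun x : ℝ => -(Complex.I * x)) (-(Complex.I * 1)) x :=
        (Complex.ofRealCLM.hasDerivAt.const_mul Complex.I).neg
      simpa using this.cexp
    have e2 := hasDerivAt_cexp_I_mul x
    have h := (e1.mul h1).add ((e2.mul h2).const_mul ((k / (p + 1 + k) : ℝ) : ℂ))
    refine h.congr_deriv ?_
    simp only [szego, neg_neg]
    have hs : (Complex.sin x : ℂ) ≠ 0 := by exact_mod_cast hx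
    have hpk : ((p : ℂ) + 1 + k) ≠ 0 := by
      have : (0 : ℝ) < p + 1 + k := by positivity
      exact_mod_cast this.ne'
    push_cast
    have hne := Complex.exp_ne_zero (Complex.I * x)
    rw [sin_eq_cexp_I_mul] at hs ⊢
    rw [Complex.exp_neg]
    generalize Complex.exp (Complex.I * x) = w at *
    have hw2 : 1 - w ^ 2 ≠ 0 := by
      intro h0
      apply hs
      have : w * w = 1 := by linear_combination -h0
      rw [inv_eq_of_mul_eq_one_left this]
      simp
    -- what remains is an identity in `w = e^{ix}`, `a = G_p(ix)` and `b = G_p(-ix)`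
    generalize szego k p (Complex.I * x) = a
    generalize szego k p (-(Complex.I * x)) = b
    have hI := Complex.I_sq
    simp
    field_simp
    ring_nf
    simp only [hI]
    ring

/-- The Heckman-Opdam polynomial `E_n` in closed form: `E_{-p}(z) = G_p(z)` for `p ≥ 0`, and
`E_{p+1}(z) = e^z G_p(-z)`. -/
def explicitPoly (k : ℝ) (n : ℤ) (z : ℂ) : ℂ :=
  if 0 < n then Complex.exp z * szego k (n - 1).toNat (-z) else szego k (-n).toNat z

/-- The eigenvalue of the Cherednik operator on `E_n`: `n + k` for `n > 0` and `n - k` for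
`n ≤ 0`. -/
def spectralValue (k : ℝ) (n : ℤ) : ℝ := if 0 < n then n + k else n - k

theorem explicitPoly_conj (k : ℝ) (n : ℤ) (z : ℂ) :
    (starRingEnd ℂ) (explicitPoly k n z) = explicitPoly k n ((starRingEnd ℂ) z) := by
  unfold explicitPoly
  split_ifs <;> simp [szego_conj, ← Complex.exp_conj]

theorem differentiable_explicitPoly (k : ℝ) (n : ℤ) : Differentiable ℂ (explicitPoly k n) := by
  unfold explicitPoly
  split_ifs
  · exact Complex.differentiable_exp.mul ((differentiable_szego k _).comp differentiable_neg)
  · exact differentiable_szego k _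

theorem hasDerivAt_explicitPoly {k : ℝ} (hk : 0 ≤ k) (n : ℤ) {x : ℝ} (hx : Real.sin x ≠ 0) :
    HasDerivAt (fun x : ℝ => explicitPoly k n (Complex.I * x))
      (Complex.I * (spectralValue k n + k) * explicitPoly k n (Complex.I * x) -
        k * Complex.exp (Complex.I * x) *
          (explicitPoly k n (Complex.I * x) - explicitPoly k n (-(Complex.I * x))) /
            Real.sin x) x := by
  unfold explicitPoly spectralValue
  split_ifs with hn
  · obtain ⟨p, rfl⟩ : ∃ p : ℕ, n = p + 1 := ⟨(n - 1).toNat, by omega⟩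
    have hx' : Real.sin (-x) ≠ 0 := by simpa using hx
    have h2 := (hasDerivAt_szego hk p hx').scomp x (hasDerivAt_neg x)
    simp only [Function.comp_def, Complex.ofReal_neg, mul_neg, neg_neg, Real.sin_neg] at h2
    have e2 := hasDerivAt_cexp_I_mul x
    simp only [add_sub_cancel_right, Int.toNat_natCast, neg_neg]
    refine (e2.mul h2).congr_deriv ?_
    have hs : (Complex.sin x : ℂ) ≠ 0 := by exact_mod_cast hx
    push_cast
    have hne := Complex.exp_ne_zero (Complex.I * x)
    rw [sin_eq_cexp_I_mul] at hs ⊢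
    rw [Complex.exp_neg]
    generalize Complex.exp (Complex.I * x) = w at *
    have hw2 : 1 - w ^ 2 ≠ 0 := by
      intro h0
      apply hs
      have : w * w = 1 := by linear_combination -h0
      rw [inv_eq_of_mul_eq_one_left this]
      simp
    generalize szego k p (Complex.I * x) = a
    generalize szego k p (-(Complex.I * x)) = b
    have hI := Complex.I_sq
    simp
    field_simp
    ring_nf
    simp only [hI]
    ring
  · obtain ⟨p, rfl⟩ : ∃ p : ℕ, n = -p := ⟨(-n).toNat, by omega⟩
    simp only [neg_neg, Int.toNat_natCast]
    refine (hasDerivAt_szego hk p hx).congr_deriv ?_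
    push_cast
    ring

/-! ### Leading terms -/

theorem map_mem_lowerSpan {L : (ℂ → ℂ) →ₗ[ℂ] (ℂ → ℂ)} {φ : ℤ → ℤ}
    (hL : ∀ j, L (expFun j) = expFun (φ j)) {n n' : ℤ}
    (h : ∀ j, Below j n → Below (φ j) n') {f : ℂ → ℂ} (hf : f ∈ lowerSpan n) :
    L f ∈ lowerSpan n' := by
  have : lowerSpan n ≤ (lowerSpan n').comap L := by
    unfold lowerSpan
    rw [Submodule.span_le]
    rintro _ ⟨j, hj, rfl⟩
    change L (expFun j) ∈ lowerSpan n'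
    rw [hL]
    exact Submodule.subset_span ⟨φ j, h j hj, rfl⟩
  exact this hf

/-- Multiplication by `e^{-z}`; it shifts the frequencies `j ↦ j - 1`. -/
def mulExpNeg : (ℂ → ℂ) →ₗ[ℂ] (ℂ → ℂ) where
  toFun f z := Complex.exp (-z) * f z
  map_add' f g := by funext z; simp [mul_add]
  map_smul' c f := by funext z; simp [mul_left_comm]

/-- The reflection `z ↦ -z` followed by multiplication by `e^z`; it maps the frequencies by
`j ↦ 1 - j`. -/
def mulExpReflect : (ℂ → ℂ) →ₗ[ℂ] (ℂ → ℂ) where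
  toFun f z := Complex.exp z * f (-z)
  map_add' f g := by funext z; simp [mul_add]
  map_smul' c f := by funext z; simp [mul_left_comm]

theorem mulExpNeg_expFun (j : ℤ) : mulExpNeg (expFun j) = expFun (j - 1) := by
  funext z
  simp only [mulExpNeg, expFun, LinearMap.coe_mk, AddHom.coe_mk, ← Complex.exp_add]
  push_cast
  ring_nf

theorem mulExpReflect_expFun (j : ℤ) : mulExpReflect (expFun j) = expFun (1 - j) := by
  funext z
  simp only [mulExpReflect, expFun, LinearMap.coe_mk, AddHom.coe_mk, ← Complex.exp_add]
  push_cast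
  ring_nf

theorem below_neg_iff {j : ℤ} {p : ℕ} :
    Below j (-p) ↔ -(p : ℤ) < j ∧ j ≤ p ∧ Even (p - j) := by
  unfold Below
  rw [abs_neg, Nat.abs_cast]
  constructor
  · rintro (⟨h1, h2⟩ | ⟨h1, h2⟩)
    · rw [Int.even_sub, even_abs, ← Int.even_sub] at h2
      have := abs_lt.mp h1
      exact ⟨this.1, this.2.le, h2⟩
    · have : j = p := by
        rcases abs_eq (by positivity : (0 : ℤ) ≤ p) |>.mp h1 with h | h <;> omega
      subst this
      simpa using h2
  · rintro ⟨h1, h2, h3⟩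
    rcases h2.lt_or_eq with h | h
    · refine Or.inl ⟨abs_lt.mpr ⟨h1, h⟩, ?_⟩
      rwa [Int.even_sub, even_abs, ← Int.even_sub]
    · subst h
      exact Or.inr ⟨by simp, h1⟩

theorem below_pos_iff {j : ℤ} {p : ℕ} :
    Below j (p + 1) ↔ -((p : ℤ) + 1) < j ∧ j < p + 1 ∧ Even (p + 1 - j) := by
  unfold Below
  rw [abs_of_nonneg (by positivity : (0 : ℤ) ≤ p + 1), Int.even_sub, even_abs, ← Int.even_sub,
    abs_lt]
  constructor
  · rintro (⟨h1, h2⟩ | ⟨h1, h2⟩)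
    · exact ⟨h1.1, h1.2, h2⟩
    · have := le_abs_self j
      omega
  · rintro ⟨h1, h2, h3⟩
    exact Or.inl ⟨⟨h1, h2⟩, h3⟩

theorem szego_lead (k : ℝ) (p : ℕ) : szego k p - expFun (-p) ∈ lowerSpan (-p) := by
  induction p with
  | zero =>
    have : szego k 0 - expFun (-((0 : ℕ) : ℤ)) = 0 := by
      funext z; simp [szego, expFun]
    rw [this]
    exact Submodule.zero_mem _
  | succ p ih =>
    have h1 : mulExpNeg (szego k p - expFun (-p)) ∈ lowerSpan (-((p + 1 : ℕ) : ℤ)) := by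
      refine map_mem_lowerSpan mulExpNeg_expFun (fun j hj => ?_) ih
      rw [below_neg_iff] at hj ⊢
      push_cast
      refine ⟨by omega, by omega, ?_⟩
      obtain ⟨r, hr⟩ := hj.2.2
      exact ⟨r + 1, by omega⟩
    have h2 : mulExpReflect (szego k p - expFun (-p)) ∈ lowerSpan (-((p + 1 : ℕ) : ℤ)) := by
      refine map_mem_lowerSpan mulExpReflect_expFun (fun j hj => ?_) ih
      rw [below_neg_iff] at hj ⊢
      push_cast
      refine ⟨by omega, by omega, ?_⟩
      obtain ⟨r, hr⟩ := hj.2.2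
      exact ⟨p - r, by omega⟩
    have h3 : expFun (p + 1) ∈ lowerSpan (-((p + 1 : ℕ) : ℤ)) := by
      refine Submodule.subset_span ⟨_, ?_, rfl⟩
      change Below _ _
      rw [below_neg_iff]
      push_cast
      exact ⟨by omega, le_rfl, by simp⟩
    have e : szego k (p + 1) - expFun (-((p + 1 : ℕ) : ℤ)) =
        mulExpNeg (szego k p - expFun (-p)) + ((k / (p + 1 + k) : ℝ) : ℂ) •
          (mulExpReflect (szego k p - expFun (-p)) + expFun (p + 1)) := by
      rw [map_sub, map_sub, mulExpNeg_expFun, mulExpReflect_expFun]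
      have : (1 : ℤ) - -p = p + 1 := by ring
      rw [this]
      have : (-(p : ℤ) - 1) = -((p + 1 : ℕ) : ℤ) := by push_cast; ring
      rw [this]
      funext z
      simp [szego, mulExpNeg, mulExpReflect]
      ring
    rw [e]
    exact Submodule.add_mem _ h1 (Submodule.smul_mem _ _ (Submodule.add_mem _ h2 h3))

theorem explicitPoly_neg_natCast (k : ℝ) (p : ℕ) : explicitPoly k (-p) = szego k p := by
  funext z
  simp [explicitPoly]

theorem explicitPoly_natCast_add_one (k : ℝ) (p : ℕ) (z : ℂ) :
    explicitPoly k (p + 1) z = Complex.exp z * szego k p (-z) := by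
  have : (0 : ℤ) < p + 1 := by positivity
  simp [explicitPoly, this]

theorem explicitPoly_lead (k : ℝ) (n : ℤ) : explicitPoly k n - expFun n ∈ lowerSpan n := by
  by_cases hn : 0 < n
  · obtain ⟨p, rfl⟩ : ∃ p : ℕ, n = p + 1 := ⟨(n - 1).toNat, by omega⟩
    have h : mulExpReflect (szego k p - expFun (-p)) ∈ lowerSpan (p + 1) := by
      refine map_mem_lowerSpan mulExpReflect_expFun (fun j hj => ?_) (szego_lead k p)
      rw [below_neg_iff] at hj
      rw [below_pos_iff]
      refine ⟨by omega, by omega, ?_⟩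
      obtain ⟨r, hr⟩ := hj.2.2
      exact ⟨p - r, by omega⟩
    convert h using 1
    rw [map_sub, mulExpReflect_expFun]
    have : (1 : ℤ) - -p = p + 1 := by ring
    rw [this]
    funext z
    simp [mulExpReflect, explicitPoly_natCast_add_one]
  · obtain ⟨p, rfl⟩ : ∃ p : ℕ, n = -p := ⟨(-n).toNat, by omega⟩
    rw [explicitPoly_neg_natCast]
    exact szego_lead k p

/-! ### Reflection of the circle -/

theorem szego_add_two_pi_I (k : ℝ) (p : ℕ) (z : ℂ) :
    szego k p (z + 2 * Real.pi * Complex.I) = szego k p z := by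
  induction p generalizing z with
  | zero => simp [szego]
  | succ p ih =>
    have h : szego k p (-(z + 2 * Real.pi * Complex.I)) = szego k p (-z) := by
      rw [← ih]; congr 1; ring
    have h1 : Complex.exp (-(z + 2 * Real.pi * Complex.I)) = Complex.exp (-z) := by
      rw [neg_add, ← sub_eq_add_neg]; exact Complex.exp_periodic.sub_eq _
    simp only [szego, h, ih, h1]
    rw [Complex.exp_periodic z]

theorem explicitPoly_add_two_pi_I (k : ℝ) (n : ℤ) (z : ℂ) :
    explicitPoly k n (z + 2 * Real.pi * Complex.I) = explicitPoly k n z := by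
  unfold explicitPoly
  split_ifs
  · rw [Complex.exp_periodic z]
    congr 1
    rw [← szego_add_two_pi_I]; congr 1; ring
  · exact szego_add_two_pi_I _ _ _

theorem onCircle_explicitPoly_neg (k : ℝ) (n : ℤ) (x : ℝ) :
    explicitPoly k n (-(Complex.I * x)) = (starRingEnd ℂ) (explicitPoly k n (Complex.I * x)) := by
  rw [explicitPoly_conj]; simp

theorem onCircle_explicitPoly_two_pi_sub (k : ℝ) (n : ℤ) (x : ℝ) :
    explicitPoly k n (Complex.I * (2 * Real.pi - x : ℝ)) =
      (starRingEnd ℂ) (explicitPoly k n (Complex.I * x)) := by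
  rw [← onCircle_explicitPoly_neg, ← explicitPoly_add_two_pi_I k n (-(Complex.I * x))]
  congr 1; push_cast; ring

/-- The reflection `x ↦ 2π - x` reduces the integral over the circle of a function that turns into
its conjugate under it to an integral over `[0, π]`. -/
theorem integral_circle_eq_re {f : ℝ → ℂ} (hf : Continuous f)
    (h : ∀ x, f (2 * Real.pi - x) = (starRingEnd ℂ) (f x)) :
    ∫ x in (0 : ℝ)..(2 * Real.pi), f x =
      ((2 * ∫ x in (0 : ℝ)..Real.pi, (f x).re : ℝ) : ℂ) := by
  have h1 : ∫ x in Real.pi..(2 * Real.pi), f x =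
      ∫ x in (0 : ℝ)..Real.pi, (starRingEnd ℂ) (f x) := by
    have := intervalIntegral.integral_comp_sub_left f (a := 0) (b := Real.pi) (2 * Real.pi)
    simp only [h, sub_zero] at this
    rw [this]
    congr 1; ring
  have hc : Continuous fun x => (starRingEnd ℂ) (f x) := Complex.continuous_conj.comp hf
  rw [← intervalIntegral.integral_add_adjacent_intervals (b := Real.pi)
    (hf.intervalIntegrable _ _) (hf.intervalIntegrable _ _), h1,
    ← intervalIntegral.integral_add (hf.intervalIntegrable _ _)
      (hc.intervalIntegrable _ _)]
  simp only [Complex.add_conj]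
  rw [intervalIntegral.integral_ofReal]
  congr 1
  exact intervalIntegral.integral_const_mul _ _

/-! ### The first-order system on `[0, π]` and orthogonality -/

/-- The square root `(2 sin x)^k` of the weight, for `x ∈ [0, π]`. -/
def halfWeight (k x : ℝ) : ℝ := (2 * Real.sin x) ^ k

theorem continuous_halfWeight {k : ℝ} (hk : 0 ≤ k) : Continuous (halfWeight k) := by
  unfold halfWeight
  exact Continuous.rpow_const (by fun_prop) (fun _ => Or.inr hk)

theorem halfWeight_sq (k : ℝ≥0) {x : ℝ} (hx : 0 ≤ Real.sin x) :
    halfWeight k x ^ 2 = weight k x := by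
  unfold halfWeight weight
  rw [abs_of_nonneg (by positivity), mul_comm (2 : ℝ) k, Real.rpow_mul (by positivity)]
  norm_cast

theorem hasDerivAt_halfWeight (k : ℝ) {x : ℝ} (hx : 0 < Real.sin x) :
    HasDerivAt (halfWeight k) (k * (Real.cos x / Real.sin x) * halfWeight k x) x := by
  unfold halfWeight
  have h := ((Real.hasDerivAt_sin x).const_mul 2).rpow_const (p := k) (Or.inl (by positivity))
  refine h.congr_deriv ?_
  rw [Real.rpow_sub_one (by positivity)]
  field_simp

theorem weight_two_pi_sub (k : ℝ≥0) (x : ℝ) : weight k (2 * Real.pi - x) = weight k x := by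
  unfold weight
  rw [Real.sin_two_pi_sub, mul_neg, abs_neg]

/-- A pair of functions on `[0, π]` that solves the real form of the eigenvalue equation of the
Cherednik operator with eigenvalue `a`, conjugated by `(2 sin x)^k`. The second component is the
odd one, hence vanishes at both ends. -/
structure IsHalfSol (k a : ℝ) (U V : ℝ → ℝ) : Prop where
  contU : Continuous U
  contV : Continuous V
  derivU : ∀ x ∈ Set.Ioo 0 Real.pi,
    HasDerivAt U (k * (Real.cos x / Real.sin x) * U x - (a - k) * V x) x
  derivV : ∀ x ∈ Set.Ioo 0 Real.pi,
    HasDerivAt V ((a + k) * U x - k * (Real.cos x / Real.sin x) * V x) x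
  zero : V 0 = 0
  pi : V Real.pi = 0

/-- Solutions with different eigenvalues are orthogonal: `(b - a)(U U' + V V')` is the derivative
of `U V' - V U'`, which vanishes at `0` and `π`. -/
theorem IsHalfSol.integral_eq_zero {k a b : ℝ} {U V U' V' : ℝ → ℝ} (h : IsHalfSol k a U V)
    (h' : IsHalfSol k b U' V') (hab : a ≠ b) :
    ∫ x in (0 : ℝ)..Real.pi, (U x * U' x + V x * V' x) = 0 := by
  have c1 := h.contU
  have c2 := h.contV
  have c3 := h'.contU
  have c4 := h'.contV
  have key : ∫ x in (0 : ℝ)..Real.pi, (b - a) * (U x * U' x + V x * V' x) =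
      (U Real.pi * V' Real.pi - V Real.pi * U' Real.pi) - (U 0 * V' 0 - V 0 * U' 0) := by
    refine intervalIntegral.integral_eq_sub_of_hasDerivAt_of_le
      (f := fun x => U x * V' x - V x * U' x) Real.pi_pos.le
      (Continuous.continuousOn (by fun_prop)) (fun x hx => ?_)
      (Continuous.intervalIntegrable (by fun_prop) _ _)
    refine (((h.derivU x hx).mul (h'.derivV x hx)).sub
      ((h.derivV x hx).mul (h'.derivU x hx))).congr_deriv ?_
    ring
  rw [intervalIntegral.integral_const_mul, h.zero, h.pi, h'.zero, h'.pi] at key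
  have : b - a ≠ 0 := sub_ne_zero.mpr hab.symm
  simpa [this] using key

/-- The function `(2 sin x)^k Re E_n(ix)`. -/
def halfRe (k : ℝ) (n : ℤ) (x : ℝ) : ℝ :=
  halfWeight k x * (explicitPoly k n (Complex.I * x)).re

/-- The function `(2 sin x)^k Im E_n(ix)`. -/
def halfIm (k : ℝ) (n : ℤ) (x : ℝ) : ℝ :=
  halfWeight k x * (explicitPoly k n (Complex.I * x)).im

theorem continuous_explicitPoly_I_mul (k : ℝ) (n : ℤ) :
    Continuous fun x : ℝ => explicitPoly k n (Complex.I * x) := by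
  have := (differentiable_explicitPoly k n).continuous
  fun_prop

theorem isHalfSol_half {k : ℝ} (hk : 0 ≤ k) (n : ℤ) :
    IsHalfSol k (spectralValue k n) (halfRe k n) (halfIm k n) := by
  have cw := continuous_halfWeight hk
  have cE := continuous_explicitPoly_I_mul k n
  have hd : ∀ x ∈ Set.Ioo 0 Real.pi,
      HasDerivAt (fun x : ℝ => (explicitPoly k n (Complex.I * x)).re)
        (-(spectralValue k n - k) * (explicitPoly k n (Complex.I * x)).im) x ∧
      HasDerivAt (fun x : ℝ => (explicitPoly k n (Complex.I * x)).im)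
        ((spectralValue k n + k) * (explicitPoly k n (Complex.I * x)).re -
          2 * k * (Real.cos x / Real.sin x) * (explicitPoly k n (Complex.I * x)).im) x := by
    intro x hx
    have hs := Real.sin_pos_of_pos_of_lt_pi hx.1 hx.2
    have h := hasDerivAt_explicitPoly hk n hs.ne'
    have hrw : ∀ e : ℂ, Complex.I * (spectralValue k n + k) * e -
        k * Complex.exp (Complex.I * x) * (e - (starRingEnd ℂ) e) / Real.sin x =
        ((-(spectralValue k n - k) * e.im : ℝ) : ℂ) + (((spectralValue k n + k) * e.re -
          2 * k * (Real.cos x / Real.sin x) * e.im : ℝ) : ℂ) * Complex.I := by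
      intro e
      rw [Complex.sub_conj, mul_comm Complex.I (x : ℂ), Complex.exp_mul_I, ← Complex.ofReal_cos,
        ← Complex.ofReal_sin]
      have hs' : (Real.sin x : ℂ) ≠ 0 := by exact_mod_cast hs.ne'
      conv_lhs => rw [← Complex.re_add_im e]
      generalize (Real.sin x) = s at *
      push_cast
      field_simp
      simp
      linear_combination (s * (spectralValue k n - k) * e.im : ℂ) * Complex.I_sq
    rw [onCircle_explicitPoly_neg, hrw] at h
    have h1 := (Complex.reCLM.hasFDerivAt
      (x := explicitPoly k n (Complex.I * x))).comp_hasDerivAt x h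
    have h2 := (Complex.imCLM.hasFDerivAt
      (x := explicitPoly k n (Complex.I * x))).comp_hasDerivAt x h
    constructor
    · simpa only [Function.comp_def, Complex.reCLM_apply, Complex.add_re, Complex.ofReal_re,
        Complex.re_ofReal_mul, Complex.I_re, mul_zero, add_zero] using h1
    · simpa only [Function.comp_def, Complex.imCLM_apply, Complex.add_im, Complex.ofReal_im,
        Complex.im_ofReal_mul, Complex.I_im, mul_one, zero_add] using h2
  refine ⟨?_, ?_, ?_, ?_, ?_, ?_⟩
  · unfold halfRe; fun_prop
  · unfold halfIm; fun_prop
  · intro x hx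
    have hs := Real.sin_pos_of_pos_of_lt_pi hx.1 hx.2
    refine ((hasDerivAt_halfWeight k hs).mul (hd x hx).1).congr_deriv ?_
    simp only [halfRe, halfIm]; ring
  · intro x hx
    have hs := Real.sin_pos_of_pos_of_lt_pi hx.1 hx.2
    refine ((hasDerivAt_halfWeight k hs).mul (hd x hx).2).congr_deriv ?_
    simp only [halfRe, halfIm]; ring
  · have := onCircle_explicitPoly_neg k n 0
    simp only [Complex.ofReal_zero, mul_zero, neg_zero] at this
    have h2 := Complex.conj_eq_iff_im.mp this.symm
    simp [halfIm, h2]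
  · have := onCircle_explicitPoly_two_pi_sub k n Real.pi
    rw [show 2 * Real.pi - Real.pi = Real.pi by ring] at this
    have h2 := Complex.conj_eq_iff_im.mp this.symm
    simp [halfIm, h2]

theorem spectralValue_injective {k : ℝ} (hk : 0 ≤ k) : Function.Injective (spectralValue k) := by
  intro n m h
  unfold spectralValue at h
  split_ifs at h with h1 h2 h2
  · exact_mod_cast (add_right_cancel h)
  · have a : (1 : ℝ) ≤ n := by exact_mod_cast h1
    have b : (m : ℝ) ≤ 0 := by exact_mod_cast not_lt.mp h2
    linarith
  · have a : (1 : ℝ) ≤ m := by exact_mod_cast h2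
    have b : (n : ℝ) ≤ 0 := by exact_mod_cast not_lt.mp h1
    linarith
  · exact_mod_cast (sub_left_injective h)

theorem ip_explicitPoly (k : ℝ≥0) (n m : ℤ) :
    ip k (onCircle (explicitPoly k n)) (onCircle (explicitPoly k m)) =
      ((1 / Real.pi * ∫ x in (0 : ℝ)..Real.pi,
        (halfRe k n x * halfRe k m x + halfIm k n x * halfIm k m x) : ℝ) : ℂ) := by
  unfold ip onCircle
  have c1 := continuous_explicitPoly_I_mul k n
  have c2 := continuous_explicitPoly_I_mul k m
  have c3 := continuous_weight k
  rw [integral_circle_eq_re (by fun_prop)]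
  · have : ∫ x in (0 : ℝ)..Real.pi, (explicitPoly k n (Complex.I * x) *
        (starRingEnd ℂ) (explicitPoly k m (Complex.I * x)) * (weight k x : ℂ)).re =
        ∫ x in (0 : ℝ)..Real.pi,
          (halfRe k n x * halfRe k m x + halfIm k n x * halfIm k m x) := by
      refine intervalIntegral.integral_congr fun x hx => ?_
      rw [Set.uIcc_of_le Real.pi_pos.le] at hx
      have hw := halfWeight_sq k (Real.sin_nonneg_of_mem_Icc hx)
      simp only [halfRe, halfIm, ← hw]
      simp [pow_two]
      ring
    rw [this]
    push_cast
    have : (Real.pi : ℂ) ≠ 0 := by exact_mod_cast Real.pi_pos.ne'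
    field_simp
  · intro x
    rw [onCircle_explicitPoly_two_pi_sub, onCircle_explicitPoly_two_pi_sub, weight_two_pi_sub]
    simp

theorem ip_explicitPoly_eq_zero (k : ℝ≥0) {n m : ℤ} (h : n ≠ m) :
    ip k (onCircle (explicitPoly k n)) (onCircle (explicitPoly k m)) = 0 := by
  rw [ip_explicitPoly, (isHalfSol_half k.coe_nonneg n).integral_eq_zero
    (isHalfSol_half k.coe_nonneg m) ((spectralValue_injective k.coe_nonneg).ne h)]
  simp

theorem Below.trans {i j n : ℤ} (h1 : Below i j) (h2 : Below j n) : Below i n := by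
  unfold Below at *
  rcases h1 with ⟨h1, e1⟩ | ⟨h1, e1⟩ <;> rcases h2 with ⟨h2, e2⟩ | ⟨h2, e2⟩
  · refine Or.inl ⟨h1.trans h2, ?_⟩
    have := e2.add e1
    simpa using this
  · exact Or.inl ⟨h2 ▸ h1, h2 ▸ e1⟩
  · exact Or.inl ⟨h1 ▸ h2, h1 ▸ e2⟩
  · exact Or.inr ⟨h1.trans h2, e2.trans e1⟩

/-- Orthogonality to the exponentials below `n` follows from orthogonality to the `E_j` with
`j ◁ n`, since `e^{jz}` is `E_j` minus a combination of exponentials below `j`. The induction runs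
over `2|j|`, increased by one for negative `j`, which is strictly monotone for `◁`. -/
theorem isHeckmanOpdam_explicitPoly (k : ℝ≥0) (n : ℤ) :
    IsHeckmanOpdam k n (explicitPoly k n) := by
  refine ⟨explicitPoly_lead k n, ?_⟩
  have key : ∀ N : ℕ, ∀ j : ℤ, 2 * j.natAbs + (if j < 0 then 1 else 0) < N → Below j n →
      ip k (onCircle (explicitPoly k n)) (onCircle (expFun j)) = 0 := by
    intro N
    induction N with
    | zero => intro j hj; omega
    | succ N ih =>
      intro j hj hjn
      have hc := continuous_onCircle (f := explicitPoly k n) (differentiable_explicitPoly k n)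
      have hr : ∀ f ∈ lowerSpan j, ip k (onCircle f) (onCircle (explicitPoly k n)) = 0 := by
        intro f hf
        suffices Continuous (onCircle f) ∧
          ip k (onCircle f) (onCircle (explicitPoly k n)) = 0 from this.2
        unfold lowerSpan at hf
        induction hf using Submodule.span_induction with
        | mem x hx =>
          obtain ⟨i, hi, rfl⟩ := hx
          refine ⟨continuous_onCircle (expFun_mem_entire i), ?_⟩
          have hi' : Below i j := hi
          rw [← ip_conj, ih i ?_ (hi'.trans hjn), map_zero]
          simp only [Below, Int.abs_eq_natAbs] at hi'
          rcases hi' with ⟨h, -⟩ | ⟨h, h'⟩ <;> split_ifs at hj ⊢ <;> omega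
        | zero =>
          have : onCircle 0 = (0 : ℂ) • onCircle 0 := by funext x; simp [onCircle]
          refine ⟨continuous_const, ?_⟩
          rw [this, ip_smul_left, zero_mul]
        | add x y hx hy h1 h2 =>
          refine ⟨h1.1.add h2.1, ?_⟩
          have : onCircle (x + y) = onCircle x + onCircle y := rfl
          rw [this, ip_add_left k h1.1 h2.1 hc, h1.2, h2.2, add_zero]
        | smul c x hx h1 =>
          refine ⟨h1.1.const_smul c, ?_⟩
          have : onCircle (c • x) = c • onCircle x := rfl
          rw [this, ip_smul_left, h1.2, mul_zero]
      have hne : j ≠ n := by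
        rintro rfl
        rcases hjn with ⟨h, -⟩ | ⟨-, h⟩ <;> exact lt_irrefl _ h
      have h0 := ip_explicitPoly_eq_zero k hne
      have hneg : expFun j - explicitPoly k j ∈ lowerSpan j := by
        have := (lowerSpan j).neg_mem (explicitPoly_lead k j)
        simpa using this
      have e : onCircle (expFun j) =
          onCircle (explicitPoly k j) + onCircle (expFun j - explicitPoly k j) := by
        funext x; simp [onCircle]
      have c1 := continuous_onCircle (f := explicitPoly k j) (differentiable_explicitPoly k j)
      rw [← ip_conj, e, ip_add_left k c1 (continuous_onCircle (lowerSpan_le j hneg)) hc, h0,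
        hr _ hneg]
      simp
  exact fun j hj => key _ j (Nat.lt_succ_self _) hj

theorem opdamPoly_eq_explicitPoly (k : ℝ≥0) (n : ℤ) : opdamPoly k n = explicitPoly k n :=
  (existsUnique_isHeckmanOpdam k n).unique (opdamPoly_spec k n) (isHeckmanOpdam_explicitPoly k n)

/-! ### Norms -/

/-- The squared norm `‖E_n(i·)‖_k²`, as an integral over `[0, π]`. -/
def sqNorm (k : ℝ) (n : ℤ) : ℝ :=
  1 / Real.pi * ∫ x in (0 : ℝ)..Real.pi, (halfRe k n x ^ 2 + halfIm k n x ^ 2)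

theorem ipNorm_opdamPoly (k : ℝ≥0) (n : ℤ) :
    ipNorm k (onCircle (opdamPoly k n)) = Real.sqrt (sqNorm k n) := by
  unfold ipNorm sqNorm
  rw [opdamPoly_eq_explicitPoly, ip_explicitPoly, Complex.ofReal_re]
  simp only [pow_two]

theorem halfRe_sq_add_halfIm_sq (k : ℝ) (n : ℤ) (x : ℝ) :
    halfRe k n x ^ 2 + halfIm k n x ^ 2 =
      halfWeight k x ^ 2 * Complex.normSq (explicitPoly k n (Complex.I * x)) := by
  rw [Complex.normSq_apply]; unfold halfRe halfIm; ring

theorem normSq_cexp_I_mul (x : ℝ) : Complex.normSq (Complex.exp (Complex.I * x)) = 1 := by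
  rw [Complex.normSq_eq_norm_sq, mul_comm, Complex.norm_exp_ofReal_mul_I]; norm_num

theorem normSq_explicitPoly_add_one (k : ℝ) (p : ℕ) (x : ℝ) :
    Complex.normSq (explicitPoly k (p + 1) (Complex.I * x)) =
      Complex.normSq (explicitPoly k (-p) (Complex.I * x)) := by
  rw [explicitPoly_natCast_add_one, map_mul, normSq_cexp_I_mul, one_mul,
    ← explicitPoly_neg_natCast, onCircle_explicitPoly_neg, Complex.normSq_conj]

theorem sqNorm_add_one (k : ℝ) (p : ℕ) : sqNorm k (p + 1) = sqNorm k (-p) := by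
  simp only [sqNorm, halfRe_sq_add_halfIm_sq, normSq_explicitPoly_add_one]

theorem explicitPoly_rec (k : ℝ) (p : ℕ) (x : ℝ) :
    explicitPoly k (-(p + 1 : ℕ)) (Complex.I * x) =
      Complex.exp (-(Complex.I * x)) * explicitPoly k (-p) (Complex.I * x) +
        ((k / (p + 1 + k) : ℝ) : ℂ) * explicitPoly k (p + 1) (Complex.I * x) := by
  rw [explicitPoly_natCast_add_one, explicitPoly_neg_natCast, explicitPoly_neg_natCast]
  rfl

/-- The factor `1 - β²` in the squared norm of `G_{p+1} = e^{-ix} G_p + β E_{p+1}`: the function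
`e^{-ix} G_p` is a combination of the orthogonal functions `E_{-(p+1)}` and `E_{p+1}`. -/
theorem sqNorm_succ {k : ℝ} (hk : 0 ≤ k) (p : ℕ) :
    sqNorm k (-(p + 1 : ℕ)) = (1 - (k / (p + 1 + k)) ^ 2) * sqNorm k (-p) := by
  set β := k / (p + 1 + k) with hβ
  have h1 := isHalfSol_half hk (-(p + 1 : ℕ))
  have h2 := isHalfSol_half hk (p + 1)
  have h0 := isHalfSol_half hk (-p)
  have horth := h1.integral_eq_zero h2 ((spectralValue_injective hk).ne (by omega))
  have c1 := h1.contU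
  have c2 := h1.contV
  have c3 := h2.contU
  have c4 := h2.contV
  have key : ∀ x : ℝ, halfRe k (-p) x ^ 2 + halfIm k (-p) x ^ 2 =
      (halfRe k (-(p + 1 : ℕ)) x ^ 2 + halfIm k (-(p + 1 : ℕ)) x ^ 2) +
      β ^ 2 * (halfRe k (p + 1) x ^ 2 + halfIm k (p + 1) x ^ 2) -
      2 * β * (halfRe k (-(p + 1 : ℕ)) x * halfRe k (p + 1) x +
        halfIm k (-(p + 1 : ℕ)) x * halfIm k (p + 1) x) := by
    intro x
    have e : Complex.normSq (explicitPoly k (-p) (Complex.I * x)) =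
        Complex.normSq (explicitPoly k (-(p + 1 : ℕ)) (Complex.I * x) -
          (β : ℂ) * explicitPoly k (p + 1) (Complex.I * x)) := by
      rw [explicitPoly_rec, add_sub_cancel_right, map_mul]
      have := normSq_cexp_I_mul (-x)
      rw [Complex.ofReal_neg, mul_neg] at this
      rw [this, one_mul]
    rw [halfRe_sq_add_halfIm_sq k (-p), e, Complex.normSq_apply]
    simp only [halfRe, halfIm, Complex.sub_re, Complex.sub_im, Complex.re_ofReal_mul,
      Complex.im_ofReal_mul]
    ring
  have hI : sqNorm k (-p) = sqNorm k (-(p + 1 : ℕ)) + β ^ 2 * sqNorm k (p + 1) := by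
    unfold sqNorm
    simp only [key]
    rw [intervalIntegral.integral_sub, intervalIntegral.integral_add,
      intervalIntegral.integral_const_mul, intervalIntegral.integral_const_mul, horth]
    · ring
    all_goals exact Continuous.intervalIntegrable (by fun_prop) _ _
  rw [sqNorm_add_one] at hI
  linarith

theorem one_sub_sq_pos {k : ℝ} (hk : 0 ≤ k) (p : ℕ) : 0 < 1 - (k / (p + 1 + k)) ^ 2 := by
  have h0 : 0 ≤ k / (p + 1 + k) := by positivity
  have h1 : k / (p + 1 + k) < 1 := by
    rw [div_lt_one (by positivity)]
    have : (0 : ℝ) ≤ p := p.cast_nonneg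
    linarith
  nlinarith

theorem sqNorm_pos {k : ℝ} (hk : 0 ≤ k) (n : ℤ) : 0 < sqNorm k n := by
  have hneg : ∀ p : ℕ, 0 < sqNorm k (-p) := by
    intro p
    induction p with
    | zero =>
      unfold sqNorm
      have h0 := isHalfSol_half hk (-(0 : ℕ))
      have c1 := h0.contU
      have c2 := h0.contV
      refine mul_pos (by positivity) ?_
      refine intervalIntegral.intervalIntegral_pos_of_pos_on
        (Continuous.intervalIntegrable (by fun_prop) _ _) (fun x hx => ?_) Real.pi_pos
      have hs := Real.sin_pos_of_pos_of_lt_pi hx.1 hx.2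
      have hw : 0 < halfWeight k x := Real.rpow_pos_of_pos (by positivity) _
      rw [halfRe_sq_add_halfIm_sq, explicitPoly_neg_natCast]
      simp only [szego, map_one]
      positivity
    | succ p ih =>
      rw [sqNorm_succ hk]
      exact mul_pos (one_sub_sq_pos hk p) ih
  by_cases hn : 0 < n
  · obtain ⟨p, rfl⟩ : ∃ p : ℕ, n = p + 1 := ⟨(n - 1).toNat, by omega⟩
    rw [sqNorm_add_one]; exact hneg p
  · obtain ⟨p, rfl⟩ : ∃ p : ℕ, n = -p := ⟨(-n).toNat, by omega⟩
    exact hneg p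

/-! ### Uniform bounds -/

/-- The squared modulus `|G_p(ix)|² / ‖G_p‖_k²` of the normalized polynomial, without the
weight. -/
def density (k : ℝ) (p : ℕ) (x : ℝ) : ℝ :=
  Complex.normSq (szego k p (Complex.I * x)) / sqNorm k (-p)

theorem density_nonneg {k : ℝ} (hk : 0 ≤ k) (p : ℕ) (x : ℝ) : 0 ≤ density k p x :=
  div_nonneg (Complex.normSq_nonneg _) (sqNorm_pos hk _).le

theorem szego_succ_I_mul (k : ℝ) (p : ℕ) (x : ℝ) :
    szego k (p + 1) (Complex.I * x) =
      (Complex.exp (Complex.I * x))⁻¹ * szego k p (Complex.I * x) +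
        ((k / (p + 1 + k) : ℝ) : ℂ) * (Complex.exp (Complex.I * x) *
          (starRingEnd ℂ) (szego k p (Complex.I * x))) := by
  rw [← Complex.exp_neg, szego_conj]
  simp [szego]

theorem norm_cexp_I_mul (x : ℝ) : ‖Complex.exp (Complex.I * x)‖ = 1 := by
  rw [mul_comm, Complex.norm_exp_ofReal_mul_I]

/-- With `β = k / (p + 1 + k)`, the squared modulus grows at most by `(1 + β)²` and the squared
norm by `1 - β²`; the quotient of the two factors is `1 + 2k / (p + 1)`. -/
theorem density_succ_le {k : ℝ} (hk : 0 ≤ k) (p : ℕ) (x : ℝ) :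
    density k (p + 1) x ≤ (1 + 2 * k / (p + 1)) * density k p x := by
  unfold density
  rw [sqNorm_succ hk, szego_succ_I_mul]
  have hν := sqNorm_pos hk (-p)
  have hβ0 : 0 ≤ k / (p + 1 + k) := by positivity
  have hpos := one_sub_sq_pos hk p
  have hid : (1 + k / (p + 1 + k)) ^ 2 =
      (1 + 2 * k / (p + 1)) * (1 - (k / (p + 1 + k)) ^ 2) := by
    have : (p : ℝ) + 1 + k ≠ 0 := by positivity
    field_simp
    ring
  set β := k / (p + 1 + k)
  set z := szego k p (Complex.I * x)
  have hn : ‖(Complex.exp (Complex.I * x))⁻¹ * z + (β : ℂ) * (Complex.exp (Complex.I * x) *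
      (starRingEnd ℂ) z)‖ ≤ (1 + β) * ‖z‖ := by
    refine (norm_add_le _ _).trans (le_of_eq ?_)
    simp only [norm_mul, norm_inv, norm_cexp_I_mul, RCLike.norm_conj, Complex.norm_real,
      Real.norm_of_nonneg hβ0]
    ring
  rw [Complex.normSq_eq_norm_sq, Complex.normSq_eq_norm_sq, ← mul_div_assoc,
    div_le_div_iff₀ (by positivity) hν]
  have h2 := pow_le_pow_left₀ (norm_nonneg _) hn 2
  rw [mul_pow, hid] at h2
  calc _ ≤ _ := mul_le_mul_of_nonneg_right h2 hν.le
    _ = _ := by ring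

/-- The bound of the normalized polynomials by a power of the degree, which is sharp for `x` within
`1 / p` of the zeros of the weight. -/
theorem density_le_rpow {k : ℝ} (hk : 0 ≤ k) (p : ℕ) (x : ℝ) :
    density k p x ≤ (1 + 2 * k) * density k 0 x * (max p 1 : ℝ) ^ (2 * k) := by
  have h0 := density_nonneg hk 0 x
  have hsucc : ∀ p : ℕ, density k (p + 1) x ≤
      (1 + 2 * k) * density k 0 x * (p + 1 : ℝ) ^ (2 * k) := by
    intro p
    induction p with
    | zero => simpa using density_succ_le hk 0 x
    | succ p ih =>
      refine (density_succ_le hk (p + 1) x).trans ?_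
      have hp : (0 : ℝ) < p + 1 := by positivity
      have hq : (0 : ℝ) < p + 1 + 1 := by positivity
      push_cast
      have h1 : 1 + 2 * k / (p + 1 + 1) ≤ ((p + 1 + 1) / (p + 1) : ℝ) ^ (2 * k) := by
        rw [Real.rpow_def_of_pos (by positivity)]
        refine le_trans ?_ (Real.exp_le_exp.mpr ?_) (b := Real.exp (2 * k / (p + 1 + 1)))
        · rw [add_comm]; exact Real.add_one_le_exp _
        · have h3 := Real.one_sub_inv_le_log_of_pos (x := (p + 1 + 1) / (p + 1 : ℝ))
            (by positivity)
          have h4 : 1 - ((p + 1 + 1) / (p + 1 : ℝ))⁻¹ = 1 / (p + 1 + 1) := by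
            field_simp; ring
          rw [h4] at h3
          calc 2 * k / (p + 1 + 1 : ℝ) = 1 / (p + 1 + 1) * (2 * k) := by ring
            _ ≤ _ := mul_le_mul_of_nonneg_right h3 (by positivity)
      calc (1 + 2 * k / (p + 1 + 1)) * density k (p + 1) x
          ≤ ((p + 1 + 1) / (p + 1) : ℝ) ^ (2 * k) *
            ((1 + 2 * k) * density k 0 x * (p + 1 : ℝ) ^ (2 * k)) :=
            mul_le_mul h1 ih (density_nonneg hk _ _) (by positivity)
        _ = _ := by
            rw [Real.div_rpow hq.le hp.le]
            field_simp
  cases p with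
  | zero => simp; nlinarith
  | succ p =>
    have : (max ((p + 1 : ℕ) : ℝ) 1) = p + 1 := by
      push_cast
      exact max_eq_left (by linarith [(p.cast_nonneg : (0 : ℝ) ≤ p)])
    rw [this]
    exact hsucc p

/-- One step of Szegő's recursion, with coefficient `β` at the point `w` of the unit circle,
multiplies the quadratic form `|z|² + 2β Re(z² / (w² - 1))` by `1 - β²`, the factor by which the
squared norm changes. -/
theorem energy_step {w : ℂ} (hw : (starRingEnd ℂ) w = w⁻¹) (hw0 : w ≠ 0) (hw2 : w ^ 2 - 1 ≠ 0)
    (z : ℂ) (β : ℝ) :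
    Complex.normSq (w⁻¹ * z + β * (w * (starRingEnd ℂ) z)) +
        2 * β * ((w ^ 2 - 1)⁻¹ * (w⁻¹ * z + β * (w * (starRingEnd ℂ) z)) ^ 2).re =
      (1 - β ^ 2) * (Complex.normSq z + 2 * β * ((w ^ 2 - 1)⁻¹ * z ^ 2).re) := by
  apply Complex.ofReal_injective
  push_cast
  have hw3 : (w⁻¹) ^ 2 - 1 ≠ 0 := by
    intro h
    apply hw2
    field_simp at h
    linear_combination -h
  have hconj : ((w⁻¹) ^ 2 - 1)⁻¹ = - (w ^ 2 * (w ^ 2 - 1)⁻¹) := by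
    have hw4 : 1 - w ^ 2 ≠ 0 := fun h => hw2 (by linear_combination -h)
    field_simp
    ring
  simp only [← Complex.mul_conj, Complex.re_eq_add_conj, map_mul, map_add, map_inv₀, map_pow,
    map_sub, map_one, hw, Complex.conj_ofReal, Complex.conj_conj, inv_inv, hconj]
  field_simp
  ring

/-- The quadratic form of `energy_step` at `G_p(ix)`, with the coefficient `β = k / (p + k)`,
divided by the squared norm of `G_p`. Between consecutive `p` it changes only through `β`. -/
def energy (k : ℝ) (p : ℕ) (x : ℝ) : ℝ :=
  (Complex.normSq (szego k p (Complex.I * x)) + 2 * (k / (p + k)) *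
    ((Complex.exp (Complex.I * x) ^ 2 - 1)⁻¹ * szego k p (Complex.I * x) ^ 2).re) /
      sqNorm k (-p)

theorem norm_cexp_sq_sub_one {x : ℝ} (hs : 0 < Real.sin x) :
    ‖Complex.exp (Complex.I * x) ^ 2 - 1‖ = 2 * Real.sin x := by
  have h : Complex.exp (Complex.I * x) ^ 2 - 1 =
      Complex.exp (Complex.I * x) * (2 * Complex.I * Real.sin x) := by
    have h2 := Complex.I_sq
    have hne := Complex.exp_ne_zero (Complex.I * x)
    rw [Complex.ofReal_sin, sin_eq_cexp_I_mul]
    field_simp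
    linear_combination (Complex.exp (Complex.I * x) ^ 2 - 1) * h2
  rw [h, norm_mul, norm_cexp_I_mul]
  simp only [norm_mul, Complex.norm_I, Complex.norm_real, Real.norm_of_nonneg hs.le]
  norm_num

theorem abs_re_inv_mul_sq_le {x : ℝ} (hs : 0 < Real.sin x) (z : ℂ) :
    |2 * ((Complex.exp (Complex.I * x) ^ 2 - 1)⁻¹ * z ^ 2).re| ≤
      Complex.normSq z / Real.sin x := by
  rw [abs_mul, abs_two]
  calc 2 * |((Complex.exp (Complex.I * x) ^ 2 - 1)⁻¹ * z ^ 2).re|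
      ≤ 2 * ‖(Complex.exp (Complex.I * x) ^ 2 - 1)⁻¹ * z ^ 2‖ := by
        gcongr; exact Complex.abs_re_le_norm _
    _ = _ := by
        rw [norm_mul, norm_inv, norm_cexp_sq_sub_one hs, norm_pow, Complex.normSq_eq_norm_sq]
        field_simp

/-- Away from the zeros of the weight, at the scale `1 / p`, energy and density are comparable. -/
theorem abs_energy_sub_density_le {k : ℝ} (hk : 0 ≤ k) {p : ℕ} {x : ℝ} (hs : 0 < Real.sin x)
    (hp : 2 * k ≤ p * Real.sin x) :
    |energy k p x - density k p x| ≤ density k p x / 2 := by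
  have hν := sqNorm_pos hk (-p)
  have h := abs_re_inv_mul_sq_le hs (szego k p (Complex.I * x))
  have e : energy k p x - density k p x = (k / (p + k)) *
    (2 * ((Complex.exp (Complex.I * x) ^ 2 - 1)⁻¹ * szego k p (Complex.I * x) ^ 2).re) /
      sqNorm k (-p) := by
    unfold energy density; ring
  rw [e, abs_div, abs_of_pos hν, abs_mul, abs_of_nonneg (by positivity : 0 ≤ k / (p + k))]
  unfold density
  rw [div_div, mul_comm _ (2 : ℝ), ← div_div]
  gcongr
  have hβ : k / (p + k) / Real.sin x ≤ 1 / 2 := by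
    rw [div_div]
    apply div_le_of_le_mul₀ (by positivity) (by norm_num)
    nlinarith
  calc _ ≤ k / (p + k) * (Complex.normSq (szego k p (Complex.I * x)) / Real.sin x) := by gcongr
    _ = k / (p + k) / Real.sin x * Complex.normSq (szego k p (Complex.I * x)) := by ring
    _ ≤ 1 / 2 * Complex.normSq (szego k p (Complex.I * x)) := by
        gcongr; exact Complex.normSq_nonneg _
    _ = _ := by ring

theorem energy_succ_le {k : ℝ} (hk : 0 ≤ k) {p : ℕ} (hp1 : 1 ≤ p) {x : ℝ} (hs : 0 < Real.sin x)
    (hp : 2 * k ≤ p * Real.sin x) :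
    energy k (p + 1) x ≤ (1 + 2 * k / Real.sin x / p ^ 2) * energy k p x := by
  have hν := sqNorm_pos hk (-p)
  have hp0 : (0 : ℝ) < p := by exact_mod_cast hp1
  set w := Complex.exp (Complex.I * x) with hw
  have hw0 : w ≠ 0 := Complex.exp_ne_zero _
  have hw2 : w ^ 2 - 1 ≠ 0 := by
    rw [← norm_pos_iff, norm_cexp_sq_sub_one hs]; positivity
  have hwc : (starRingEnd ℂ) w = w⁻¹ := by
    rw [hw, ← Complex.exp_conj, ← Complex.exp_neg]; simp
  have e : energy k (p + 1) x = energy k p x + (k / (p + 1 + k) - k / (p + k)) *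
      (2 * ((w ^ 2 - 1)⁻¹ * szego k p (Complex.I * x) ^ 2).re) / sqNorm k (-p) := by
    unfold energy
    rw [sqNorm_succ hk, szego_succ_I_mul, ← hw]
    push_cast
    have h := energy_step hwc hw0 hw2 (szego k p (Complex.I * x)) (k / (p + 1 + k))
    push_cast at h
    rw [h, mul_div_mul_left _ _ (one_sub_sq_pos hk p).ne']
    ring
  have hed := abs_le.mp (abs_energy_sub_density_le hk hs hp)
  have hd := density_nonneg hk p x
  have hle : (k / (p + 1 + k) - k / (p + k)) *
      (2 * ((w ^ 2 - 1)⁻¹ * szego k p (Complex.I * x) ^ 2).re) / sqNorm k (-p) ≤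
      k / p ^ 2 / Real.sin x * density k p x := by
    have h := abs_re_inv_mul_sq_le hs (szego k p (Complex.I * x))
    have hβ : |k / (p + 1 + k) - k / (p + k)| ≤ k / p ^ 2 := by
      have h1 : k / (p + 1 + k) - k / (p + k) = -(k / ((p + 1 + k) * (p + k))) := by
        field_simp
        ring
      rw [h1, abs_neg, abs_of_nonneg (by positivity)]
      gcongr
      nlinarith
    have h3 := mul_le_mul hβ h (abs_nonneg _) (by positivity)
    rw [← abs_mul] at h3
    calc _ ≤ _ / sqNorm k (-p) := div_le_div_of_nonneg_right ((le_abs_self _).trans h3) hν.le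
      _ = _ := by unfold density; ring
  have : k / p ^ 2 / Real.sin x * density k p x ≤
      k / p ^ 2 / Real.sin x * (2 * energy k p x) := by
    gcongr
    linarith
  rw [e]
  calc _ ≤ energy k p x + k / p ^ 2 / Real.sin x * (2 * energy k p x) := by linarith
    _ = _ := by ring

/-- The steps of `energy_succ_le` accumulate to a bounded factor, because `1 / p²` is at most
`1 / (p - 1) - 1 / p`. -/
theorem energy_le {k : ℝ} (hk : 0 ≤ k) {x : ℝ} (hs : 0 < Real.sin x) {J : ℕ} (hJ : 1 ≤ J)
    (hJs : 2 * k ≤ J * Real.sin x) (i : ℕ) :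
    energy k (J + 1 + i) x ≤
      Real.exp (2 * k / Real.sin x * (1 / J - 1 / (J + i))) * energy k (J + 1) x := by
  have hJ0 : (0 : ℝ) < J := by exact_mod_cast hJ
  induction i with
  | zero => simp
  | succ i ih =>
    have hp : 2 * k ≤ ((J + 1 + i : ℕ) : ℝ) * Real.sin x := by
      push_cast
      have : (0 : ℝ) ≤ i := i.cast_nonneg
      nlinarith
    have h := energy_succ_le hk (by omega : 1 ≤ J + 1 + i) hs hp
    have hed := abs_le.mp (abs_energy_sub_density_le hk hs hp)
    have hd := density_nonneg hk (J + 1 + i) x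
    refine h.trans ?_
    have h1 : 1 + 2 * k / Real.sin x / ((J + 1 + i : ℕ) : ℝ) ^ 2 ≤
        Real.exp (2 * k / Real.sin x * (1 / (J + i) - 1 / (J + (i + 1)))) := by
      rw [add_comm]
      refine le_trans ?_ (Real.add_one_le_exp _)
      gcongr
      push_cast
      rw [div_eq_mul_one_div]
      gcongr
      have h0 : (0 : ℝ) < J + i := by positivity
      rw [div_sub_div _ _ h0.ne' (by positivity), div_le_div_iff₀ (by positivity) (by positivity)]
      nlinarith
    calc _ ≤ Real.exp (2 * k / Real.sin x * (1 / (J + i) - 1 / (J + (i + 1)))) *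
          (Real.exp (2 * k / Real.sin x * (1 / J - 1 / (J + i))) * energy k (J + 1) x) :=
          mul_le_mul h1 ih (by linarith) (by positivity)
      _ = _ := by
          rw [← mul_assoc, ← Real.exp_add]
          push_cast
          congr 2
          ring

/-- The normalized polynomials times the square root of the weight are bounded uniformly in the
degree. As long as `p sin x` is bounded this is the bound by a power of `p`; for larger `p` the
energy carries it on. -/
theorem exists_density_bound {k : ℝ} (hk : 0 ≤ k) :
    ∃ C, 0 < C ∧ ∀ (p : ℕ) (x : ℝ), x ∈ Set.Ioo 0 Real.pi →
      density k p x * halfWeight k x ^ 2 ≤ C := by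
  have hν := sqNorm_pos hk (-(0 : ℕ))
  set A := (1 + 2 * k) * (1 / sqNorm k (-(0 : ℕ))) with hA
  have hA0 : 0 < A := by positivity
  refine ⟨3 * Real.exp (2 * k) * A * (2 * (2 * k + 3)) ^ (2 * k), by positivity, ?_⟩
  intro p x hx
  have hs := Real.sin_pos_of_pos_of_lt_pi hx.1 hx.2
  have hs1 := Real.sin_le_one x
  have hd0 : density k 0 x = 1 / sqNorm k (-(0 : ℕ)) := by simp [density, szego]
  have hgrow : ∀ q : ℕ, (q : ℝ) ≤ (2 * k + 3) / Real.sin x →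
      density k q x ≤ A * ((2 * k + 3) / Real.sin x) ^ (2 * k) := by
    intro q hq
    refine (density_le_rpow hk q x).trans ?_
    rw [hd0, ← hA]
    gcongr
    refine max_le hq ?_
    rw [le_div_iff₀ hs]
    linarith
  -- from the index `J` on, the energy is comparable with the density
  set J := ⌈(2 * k + 1) / Real.sin x⌉₊ with hJ
  have hJ1 : (2 * k + 1) / Real.sin x ≤ J := Nat.le_ceil _
  have hJ2 : (J : ℝ) < (2 * k + 1) / Real.sin x + 1 := Nat.ceil_lt_add_one (by positivity)
  have h1s : 1 ≤ 1 / Real.sin x := by rw [le_div_iff₀ hs]; linarith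
  have hJ3 : ((J + 1 : ℕ) : ℝ) ≤ (2 * k + 3) / Real.sin x := by
    push_cast
    have : (2 * k + 3) / Real.sin x = (2 * k + 1) / Real.sin x + 2 * (1 / Real.sin x) := by ring
    linarith
  have hJs : 2 * k + 1 ≤ J * Real.sin x := (div_le_iff₀ hs).mp hJ1
  have hJpos : 1 ≤ J := by
    rw [hJ, Nat.one_le_ceil_iff]; positivity
  have hJ0 : (0 : ℝ) < J := by exact_mod_cast hJpos
  have hexp : 1 ≤ Real.exp (2 * k) := Real.one_le_exp (by positivity)
  have hmain : density k p x ≤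
      3 * Real.exp (2 * k) * (A * ((2 * k + 3) / Real.sin x) ^ (2 * k)) := by
    have hpos : 0 ≤ A * ((2 * k + 3) / Real.sin x) ^ (2 * k) := by positivity
    rcases le_or_gt p (J + 1) with hp | hp
    · refine (hgrow p ((Nat.cast_le.mpr hp).trans hJ3)).trans ?_
      nlinarith
    · obtain ⟨i, rfl⟩ := Nat.exists_eq_add_of_lt hp
      have hle := energy_le hk hs hJpos (by linarith) (i + 1)
      have hg := hgrow (J + 1) hJ3
      have c1 := abs_le.mp (abs_energy_sub_density_le hk hs (p := J + 1)
        (by push_cast; nlinarith))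
      have c2 := abs_le.mp (abs_energy_sub_density_le hk hs (p := J + 1 + i + 1)
        (by push_cast; nlinarith [(i.cast_nonneg : (0 : ℝ) ≤ i)]))
      have d1 := density_nonneg hk (J + 1) x
      have hexp2 : Real.exp (2 * k / Real.sin x * (1 / J - 1 / (J + (i + 1 : ℕ)))) ≤
          Real.exp (2 * k) := by
        apply Real.exp_le_exp.mpr
        have h1 : (1 : ℝ) / J - 1 / (J + (i + 1 : ℕ)) ≤ 1 / J := by
          have : (0 : ℝ) ≤ 1 / (J + (i + 1 : ℕ)) := by positivity
          linarith
        calc _ ≤ 2 * k / Real.sin x * (1 / J) := by gcongr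
          _ = 2 * k / (J * Real.sin x) := by field_simp
          _ ≤ 2 * k := div_le_self (by positivity) (by linarith)
      have e0 : 0 ≤ energy k (J + 1) x := by linarith
      have := mul_le_mul_of_nonneg_right hexp2 e0
      rw [← add_assoc] at hle
      have h5 : Real.exp (2 * k) * energy k (J + 1) x ≤
          Real.exp (2 * k) * (3 / 2 * (A * ((2 * k + 3) / Real.sin x) ^ (2 * k))) := by
        gcongr
        linarith
      linarith
  calc density k p x * halfWeight k x ^ 2
      ≤ 3 * Real.exp (2 * k) * (A * ((2 * k + 3) / Real.sin x) ^ (2 * k)) *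
        halfWeight k x ^ 2 := by gcongr
    _ = _ := by
      have hw : halfWeight k x ^ 2 = (2 * Real.sin x) ^ (2 * k) := by
        unfold halfWeight
        rw [mul_comm 2 k, Real.rpow_mul (by positivity)]
        norm_cast
      rw [hw, show 3 * Real.exp (2 * k) * (A * ((2 * k + 3) / Real.sin x) ^ (2 * k)) *
        (2 * Real.sin x) ^ (2 * k) = 3 * Real.exp (2 * k) * A *
        (((2 * k + 3) / Real.sin x) ^ (2 * k) * (2 * Real.sin x) ^ (2 * k)) by ring,
        ← Real.mul_rpow (by positivity) (by positivity)]
      congr 2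
      field_simp

/-- The normalized polynomial `ℰ_n(ix)` times `(2 sin x)^k`. -/
def circleFun (k : ℝ) (n : ℤ) (x : ℝ) : ℂ :=
  ((halfWeight k x / Real.sqrt (sqNorm k n) : ℝ) : ℂ) * explicitPoly k n (Complex.I * x)

theorem isHalfSol_circleFun {k : ℝ} (hk : 0 ≤ k) (n : ℤ) :
    IsHalfSol k (spectralValue k n) (fun x => (circleFun k n x).re)
      (fun x => (circleFun k n x).im) := by
  have h := isHalfSol_half hk n
  have e1 : (fun x => (circleFun k n x).re) =
      fun x => (Real.sqrt (sqNorm k n))⁻¹ * halfRe k n x := by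
    funext x
    simp only [circleFun, Complex.re_ofReal_mul, halfRe]; ring
  have e2 : (fun x => (circleFun k n x).im) =
      fun x => (Real.sqrt (sqNorm k n))⁻¹ * halfIm k n x := by
    funext x
    simp only [circleFun, Complex.im_ofReal_mul, halfIm]; ring
  rw [e1, e2]
  refine ⟨h.contU.const_mul _, h.contV.const_mul _, fun x hx => ?_, fun x hx => ?_, ?_, ?_⟩
  · exact ((h.derivU x hx).const_mul _).congr_deriv (by ring)
  · exact ((h.derivV x hx).const_mul _).congr_deriv (by ring)
  · simp [h.zero]
  · simp [h.pi]

theorem continuous_circleFun {k : ℝ} (hk : 0 ≤ k) (n : ℤ) : Continuous (circleFun k n) := by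
  have h1 := continuous_halfWeight hk
  have h2 := continuous_explicitPoly_I_mul k n
  unfold circleFun
  fun_prop

theorem circleFun_add_one (k : ℝ) (p : ℕ) (x : ℝ) :
    circleFun k (p + 1) x =
      Complex.exp (Complex.I * x) * (starRingEnd ℂ) (circleFun k (-p) x) := by
  unfold circleFun
  rw [explicitPoly_natCast_add_one, sqNorm_add_one, map_mul, Complex.conj_ofReal,
    ← onCircle_explicitPoly_neg, explicitPoly_neg_natCast]
  ring

theorem exists_norm_circleFun_le {k : ℝ} (hk : 0 ≤ k) :
    ∃ C, 0 < C ∧ ∀ (n : ℤ) (x : ℝ), x ∈ Set.Icc 0 Real.pi → ‖circleFun k n x‖ ≤ C := by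
  obtain ⟨C, hC, h⟩ := exists_density_bound hk
  refine ⟨Real.sqrt C, Real.sqrt_pos.mpr hC, ?_⟩
  have hneg : ∀ (p : ℕ) (x : ℝ), x ∈ Set.Icc 0 Real.pi → ‖circleFun k (-p) x‖ ≤ Real.sqrt C := by
    intro p x hx
    have hcl : x ∈ closure (Set.Ioo 0 Real.pi) := by
      rwa [closure_Ioo Real.pi_pos.ne]
    have hclosed : IsClosed {x | ‖circleFun k (-p) x‖ ≤ Real.sqrt C} :=
      isClosed_le (continuous_circleFun hk _).norm continuous_const
    refine closure_minimal (fun y hy => ?_) hclosed hcl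
    change ‖circleFun k (-p) y‖ ≤ _
    apply Real.le_sqrt_of_sq_le
    refine le_trans (le_of_eq ?_) (h p y hy)
    have hν := sqNorm_pos hk (-p)
    unfold circleFun density
    rw [norm_mul, mul_pow, Complex.norm_real, Real.norm_eq_abs, sq_abs, div_pow,
      Real.sq_sqrt hν.le, Complex.normSq_eq_norm_sq, explicitPoly_neg_natCast]
    ring
  intro n x hx
  by_cases hn : 0 < n
  · obtain ⟨p, rfl⟩ : ∃ p : ℕ, n = p + 1 := ⟨(n - 1).toNat, by omega⟩
    rw [circleFun_add_one, norm_mul, norm_cexp_I_mul, one_mul, RCLike.norm_conj]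
    exact hneg p x hx
  · obtain ⟨p, rfl⟩ : ∃ p : ℕ, n = -p := ⟨(-n).toNat, by omega⟩
    exact hneg p x hx

theorem norm_cexp_neg_sub_one_le {x : ℝ} (hx : x ∈ Set.Icc 0 Real.pi) :
    ‖(Complex.exp (Complex.I * x))⁻¹ - 1‖ ≤ 2 * Real.sin (x / 2) := by
  have h : (Complex.exp (Complex.I * x))⁻¹ - 1 =
      -((Complex.exp (Complex.I * x))⁻¹ * (Complex.exp (Complex.I * x) - 1)) := by
    have hne := Complex.exp_ne_zero (Complex.I * x)
    field_simp
    ring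
  rw [h, norm_neg, norm_mul, norm_inv, norm_cexp_I_mul, Complex.norm_exp_I_mul_ofReal_sub_one,
    inv_one, one_mul, Real.norm_of_nonneg]
  have := Real.sin_nonneg_of_nonneg_of_le_pi (x := x / 2) (by linarith [hx.1])
    (by linarith [hx.1, hx.2])
  positivity

/-- Consecutive normalized polynomials differ by at most a constant times
`sin (x / 2) + 1 / (p + 1)`: in Szegő's recursion `|e^{-ix} - 1| = 2 sin (x / 2)`, and the
coefficient and the change of the norm are of order `1 / (p + 1)`. -/
theorem norm_circleFun_succ_sub_le {k : ℝ} (hk : 0 ≤ k) (p : ℕ) {x : ℝ}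
    (hx : x ∈ Set.Icc 0 Real.pi) :
    ‖circleFun k (-(p + 1 : ℕ)) x - circleFun k (-p) x‖ ≤
      (2 + 2 * k ^ 2 + k) * (Real.sin (x / 2) + 1 / (p + 1)) * ‖circleFun k (-p) x‖ := by
  set β := k / (p + 1 + k) with hβ
  have hβ0 : 0 ≤ β := by positivity
  have hq : (0 : ℝ) < p + 1 := by positivity
  have hβ1 : β ≤ 1 := by
    rw [hβ, div_le_one (by positivity)]; linarith
  have hβ2 : β ≤ k / (p + 1) := by
    rw [hβ]
    exact div_le_div_of_nonneg_left hk hq (by linarith)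
  have hpos := one_sub_sq_pos hk p
  rw [← hβ] at hpos
  set ρ := Real.sqrt (1 - β ^ 2) with hρ
  have hρ0 : 0 < ρ := Real.sqrt_pos.mpr hpos
  have hρ1 : ρ ≤ 1 := Real.sqrt_le_one.mpr (by nlinarith)
  have hρ2 : ρ ^ 2 = 1 - β ^ 2 := Real.sq_sqrt hpos.le
  have hρ3 : 1 / ρ - 1 ≤ k ^ 2 / (p + 1) := by
    have h1 : 1 / ρ - 1 ≤ β ^ 2 / (1 - β ^ 2) := by
      rw [← hρ2, show β ^ 2 = 1 - ρ ^ 2 by linarith, div_sub_one hρ0.ne',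
        div_le_div_iff₀ hρ0 (by positivity)]
      nlinarith [mul_nonneg hρ0.le (sub_nonneg.mpr hρ1)]
    refine h1.trans ?_
    have h2 : β ^ 2 / (1 - β ^ 2) = k ^ 2 / ((p + 1) * (p + 1 + 2 * k)) := by
      rw [div_eq_div_iff hpos.ne' (by positivity), hβ]
      field_simp
      ring
    rw [h2]
    gcongr
    have : (0 : ℝ) ≤ p := p.cast_nonneg
    nlinarith
  have hρ4 : 0 ≤ 1 / ρ - 1 := by
    rw [sub_nonneg, le_div_iff₀ hρ0]; linarith
  set g := circleFun k (-p) x with hg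
  set w := Complex.exp (Complex.I * x) with hw
  have e : circleFun k (-(p + 1 : ℕ)) x =
      ((1 / ρ : ℝ) : ℂ) * (w⁻¹ * g + (β : ℂ) * (w * (starRingEnd ℂ) g)) := by
    rw [hg]
    unfold circleFun
    rw [explicitPoly_neg_natCast, szego_succ_I_mul, sqNorm_succ hk, ← hβ,
      Real.sqrt_mul hpos.le, ← hρ, explicitPoly_neg_natCast, map_mul, Complex.conj_ofReal]
    push_cast
    ring
  have e2 : circleFun k (-(p + 1 : ℕ)) x - g =
      ((1 / ρ - 1 : ℝ) : ℂ) * (w⁻¹ * g + (β : ℂ) * (w * (starRingEnd ℂ) g)) +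
        ((w⁻¹ - 1) * g + (β : ℂ) * (w * (starRingEnd ℂ) g)) := by
    rw [e]; push_cast; ring
  have hw1 : ‖w‖ = 1 := norm_cexp_I_mul x
  have n1 : ‖(β : ℂ) * (w * (starRingEnd ℂ) g)‖ = β * ‖g‖ := by
    rw [norm_mul, norm_mul, hw1, RCLike.norm_conj, Complex.norm_real, Real.norm_of_nonneg hβ0,
      one_mul]
  have n2 : ‖w⁻¹ * g + (β : ℂ) * (w * (starRingEnd ℂ) g)‖ ≤ 2 * ‖g‖ := by
    refine (norm_add_le _ _).trans ?_
    rw [n1, norm_mul, norm_inv, hw1]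
    nlinarith [norm_nonneg g]
  have n3 : ‖(w⁻¹ - 1) * g + (β : ℂ) * (w * (starRingEnd ℂ) g)‖ ≤
      (2 * Real.sin (x / 2) + k / (p + 1)) * ‖g‖ := by
    refine (norm_add_le _ _).trans ?_
    rw [n1, norm_mul, add_mul]
    gcongr
    exact norm_cexp_neg_sub_one_le hx
  have hsn : 0 ≤ Real.sin (x / 2) :=
    Real.sin_nonneg_of_nonneg_of_le_pi (by linarith [hx.1]) (by linarith [hx.1, hx.2])
  rw [e2]
  calc _ ≤ k ^ 2 / (p + 1) * (2 * ‖g‖) + (2 * Real.sin (x / 2) + k / (p + 1)) * ‖g‖ := by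
        refine (norm_add_le _ _).trans (add_le_add ?_ n3)
        rw [norm_mul, Complex.norm_real, Real.norm_of_nonneg hρ4]
        gcongr
    _ ≤ _ := by
        rw [← mul_assoc, ← add_mul]
        gcongr
        have : 0 ≤ 1 / ((p : ℝ) + 1) := by positivity
        rw [div_eq_mul_one_div (k ^ 2), div_eq_mul_one_div k]
        nlinarith [mul_nonneg (sq_nonneg k) hsn, mul_nonneg hk hsn]

theorem exists_norm_circleFun_sub_le {k : ℝ} (hk : 0 ≤ k) :
    ∃ C, 0 < C ∧ ∀ (n : ℤ) (x : ℝ), 0 < n ∨ n < -1 → x ∈ Set.Icc 0 Real.pi →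
      ‖circleFun k (n + 1) x - circleFun k n x‖ ≤ C * (Real.sin (x / 2) + 1 / |(n : ℝ)|) := by
  obtain ⟨C, hC, h⟩ := exists_norm_circleFun_le hk
  refine ⟨(2 + 2 * k ^ 2 + k) * C, by positivity, ?_⟩
  have hneg : ∀ (p : ℕ) (x : ℝ), x ∈ Set.Icc 0 Real.pi →
      ‖circleFun k (-(p + 1 : ℕ)) x - circleFun k (-p) x‖ ≤
      (2 + 2 * k ^ 2 + k) * C * (Real.sin (x / 2) + 1 / (p + 1)) := by
    intro p x hx
    have hsn : 0 ≤ Real.sin (x / 2) :=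
      Real.sin_nonneg_of_nonneg_of_le_pi (by linarith [hx.1]) (by linarith [hx.1, hx.2])
    refine (norm_circleFun_succ_sub_le hk p hx).trans ?_
    rw [mul_right_comm]
    gcongr
    exact h _ x hx
  intro n x hn hx
  rcases hn with hn | hn
  · obtain ⟨p, rfl⟩ : ∃ p : ℕ, n = p + 1 := ⟨(n - 1).toNat, by omega⟩
    have e := circleFun_add_one k (p + 1) x
    push_cast at e
    rw [e, circleFun_add_one, ← mul_sub, ← map_sub, norm_mul, norm_cexp_I_mul, one_mul,
      RCLike.norm_conj]
    have := hneg p x hx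
    have habs : |(((p : ℤ) + 1 : ℤ) : ℝ)| = p + 1 := by
      push_cast; exact abs_of_nonneg (by positivity)
    rw [habs]
    exact_mod_cast this
  · obtain ⟨p, rfl⟩ : ∃ p : ℕ, n = -(p + 1 : ℕ) := ⟨(-n - 1).toNat, by omega⟩
    have e : -((p + 1 : ℕ) : ℤ) + 1 = -p := by push_cast; ring
    have habs : |((-((p + 1 : ℕ) : ℤ) : ℤ) : ℝ)| = p + 1 := by
      push_cast; rw [abs_of_nonpos]
      · ring
      · have : (0 : ℝ) ≤ p := p.cast_nonneg
        linarith
    rw [e, habs, norm_sub_rev]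
    exact hneg p x hx

/-! ### Products of two solutions -/

/-- The real part of `F conj G`. -/
def pairRe (F G : ℝ → ℂ) (x : ℝ) : ℝ := (F x).re * (G x).re + (F x).im * (G x).im

/-- The imaginary part of `F conj G`. -/
def pairIm (F G : ℝ → ℂ) (x : ℝ) : ℝ := (F x).im * (G x).re - (F x).re * (G x).im

/-- The real part of `e^{-ix} F G`. -/
def twistRe (F G : ℝ → ℂ) (x : ℝ) : ℝ :=
  Real.cos x * ((F x).re * (G x).re - (F x).im * (G x).im) +
    Real.sin x * ((F x).re * (G x).im + (F x).im * (G x).re)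

/-- The imaginary part of `e^{-ix} F G`. -/
def twistIm (F G : ℝ → ℂ) (x : ℝ) : ℝ :=
  Real.cos x * ((F x).re * (G x).im + (F x).im * (G x).re) -
    Real.sin x * ((F x).re * (G x).re - (F x).im * (G x).im)

theorem pairRe_sub (F F' G : ℝ → ℂ) (x : ℝ) :
    pairRe F G x - pairRe F' G x = pairRe (F - F') G x := by
  simp only [pairRe, Pi.sub_apply, Complex.sub_re, Complex.sub_im]; ring

theorem pairIm_sub (F F' G : ℝ → ℂ) (x : ℝ) :
    pairIm F G x - pairIm F' G x = pairIm (F - F') G x := by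
  simp only [pairIm, Pi.sub_apply, Complex.sub_re, Complex.sub_im]; ring

theorem twistRe_sub (F F' G : ℝ → ℂ) (x : ℝ) :
    twistRe F G x - twistRe F' G x = twistRe (F - F') G x := by
  simp only [twistRe, Pi.sub_apply, Complex.sub_re, Complex.sub_im]; ring

theorem twistIm_sub (F F' G : ℝ → ℂ) (x : ℝ) :
    twistIm F G x - twistIm F' G x = twistIm (F - F') G x := by
  simp only [twistIm, Pi.sub_apply, Complex.sub_re, Complex.sub_im]; ring

theorem abs_pairRe_le (F G : ℝ → ℂ) (x : ℝ) : |pairRe F G x| ≤ ‖F x‖ * ‖G x‖ := by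
  have h := Complex.abs_re_le_norm (F x * (starRingEnd ℂ) (G x))
  rw [norm_mul, RCLike.norm_conj] at h
  refine le_trans (le_of_eq ?_) h
  simp [pairRe]

theorem abs_pairIm_le (F G : ℝ → ℂ) (x : ℝ) : |pairIm F G x| ≤ ‖F x‖ * ‖G x‖ := by
  have h := Complex.abs_im_le_norm (F x * (starRingEnd ℂ) (G x))
  rw [norm_mul, RCLike.norm_conj] at h
  refine le_trans (le_of_eq ?_) h
  congr 1
  simp [pairIm]
  ring

theorem twist_eq (F G : ℝ → ℂ) (x : ℝ) :
    Complex.exp ((-x : ℝ) * Complex.I) * (F x * G x) =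
      (twistRe F G x : ℂ) + (twistIm F G x : ℂ) * Complex.I := by
  rw [Complex.exp_mul_I, ← Complex.ofReal_cos, ← Complex.ofReal_sin, Real.cos_neg, Real.sin_neg]
  apply Complex.ext
  · simp [twistRe, twistIm]
  · simp [twistRe, twistIm]
    ring

theorem norm_twist (F G : ℝ → ℂ) (x : ℝ) :
    ‖(twistRe F G x : ℂ) + (twistIm F G x : ℂ) * Complex.I‖ = ‖F x‖ * ‖G x‖ := by
  rw [← twist_eq, norm_mul, norm_mul, Complex.norm_exp_ofReal_mul_I, one_mul]

theorem abs_twistRe_le (F G : ℝ → ℂ) (x : ℝ) : |twistRe F G x| ≤ ‖F x‖ * ‖G x‖ := by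
  rw [← norm_twist]
  refine le_trans (le_of_eq ?_) (Complex.abs_re_le_norm _)
  simp

theorem abs_twistIm_le (F G : ℝ → ℂ) (x : ℝ) : |twistIm F G x| ≤ ‖F x‖ * ‖G x‖ := by
  rw [← norm_twist]
  refine le_trans (le_of_eq ?_) (Complex.abs_im_le_norm _)
  simp

/-- A complex function whose real and imaginary parts solve the system `IsHalfSol`. -/
def IsCircleSol (k a : ℝ) (F : ℝ → ℂ) : Prop :=
  IsHalfSol k a (fun x => (F x).re) (fun x => (F x).im)

section Pair

variable {k a b : ℝ} {F G : ℝ → ℂ}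

theorem IsCircleSol.continuous_pairRe (hF : IsCircleSol k a F) (hG : IsCircleSol k b G) :
    Continuous (pairRe F G) :=
  (hF.contU.mul hG.contU).add (hF.contV.mul hG.contV)

theorem IsCircleSol.continuous_pairIm (hF : IsCircleSol k a F) (hG : IsCircleSol k b G) :
    Continuous (pairIm F G) :=
  (hF.contV.mul hG.contU).sub (hF.contU.mul hG.contV)

theorem IsCircleSol.continuous_twistRe (hF : IsCircleSol k a F) (hG : IsCircleSol k b G) :
    Continuous (twistRe F G) :=
  (Real.continuous_cos.mul ((hF.contU.mul hG.contU).sub (hF.contV.mul hG.contV))).add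
    (Real.continuous_sin.mul ((hF.contU.mul hG.contV).add (hF.contV.mul hG.contU)))

theorem IsCircleSol.continuous_twistIm (hF : IsCircleSol k a F) (hG : IsCircleSol k b G) :
    Continuous (twistIm F G) :=
  (Real.continuous_cos.mul ((hF.contU.mul hG.contV).add (hF.contV.mul hG.contU))).sub
    (Real.continuous_sin.mul ((hF.contU.mul hG.contU).sub (hF.contV.mul hG.contV)))

theorem IsCircleSol.hasDerivAt_pairRe (hF : IsCircleSol k a F) (hG : IsCircleSol k b G) {x : ℝ}
    (hx : x ∈ Set.Ioo 0 Real.pi) :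
    HasDerivAt (pairRe F G)
      (-(a - b) * pairIm F G x + 2 * k * (twistRe F G x / Real.sin x)) x := by
  have hs := (Real.sin_pos_of_pos_of_lt_pi hx.1 hx.2).ne'
  refine (((hF.derivU x hx).mul (hG.derivU x hx)).add
    ((hF.derivV x hx).mul (hG.derivV x hx))).congr_deriv ?_
  simp only [pairIm, twistRe]
  field_simp
  ring

theorem IsCircleSol.hasDerivAt_pairIm (hF : IsCircleSol k a F) (hG : IsCircleSol k b G) {x : ℝ}
    (hx : x ∈ Set.Ioo 0 Real.pi) :
    HasDerivAt (pairIm F G) ((a - b) * pairRe F G x) x := by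
  refine (((hF.derivV x hx).mul (hG.derivU x hx)).sub
    ((hF.derivU x hx).mul (hG.derivV x hx))).congr_deriv ?_
  simp only [pairRe]
  ring

theorem IsCircleSol.hasDerivAt_twistRe (hF : IsCircleSol k a F) (hG : IsCircleSol k b G) {x : ℝ}
    (hx : x ∈ Set.Ioo 0 Real.pi) :
    HasDerivAt (twistRe F G)
      ((1 - (a + b)) * twistIm F G x + 2 * k * (pairRe F G x / Real.sin x)) x := by
  have hs := (Real.sin_pos_of_pos_of_lt_pi hx.1 hx.2).ne'
  have hU := hF.derivU x hx
  have hV := hF.derivV x hx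
  have hU' := hG.derivU x hx
  have hV' := hG.derivV x hx
  refine (((Real.hasDerivAt_cos x).mul ((hU.mul hU').sub (hV.mul hV'))).add
    ((Real.hasDerivAt_sin x).mul ((hU.mul hV').add (hV.mul hU')))).congr_deriv ?_
  simp only [pairRe, twistIm, Pi.sub_apply, Pi.add_apply, Pi.mul_apply]
  have h1 := Real.sin_sq_add_cos_sq x
  field_simp
  linear_combination (2 * k * ((F x).re * (G x).re + (F x).im * (G x).im)) * h1

theorem IsCircleSol.hasDerivAt_twistIm (hF : IsCircleSol k a F) (hG : IsCircleSol k b G) {x : ℝ}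
    (hx : x ∈ Set.Ioo 0 Real.pi) :
    HasDerivAt (twistIm F G) ((a + b - 1) * twistRe F G x) x := by
  have hs := (Real.sin_pos_of_pos_of_lt_pi hx.1 hx.2).ne'
  have hU := hF.derivU x hx
  have hV := hF.derivV x hx
  have hU' := hG.derivU x hx
  have hV' := hG.derivV x hx
  refine (((Real.hasDerivAt_cos x).mul ((hU.mul hV').add (hV.mul hU'))).sub
    ((Real.hasDerivAt_sin x).mul ((hU.mul hU').sub (hV.mul hV')))).congr_deriv ?_
  simp only [twistRe, Pi.sub_apply, Pi.add_apply, Pi.mul_apply]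
  field_simp
  ring

theorem IsCircleSol.pairIm_pi (hF : IsCircleSol k a F) (hG : IsCircleSol k b G) :
    pairIm F G Real.pi = 0 := by
  have h1 : (F Real.pi).im = 0 := hF.pi
  have h2 : (G Real.pi).im = 0 := hG.pi
  simp [pairIm, h1, h2]

theorem IsCircleSol.twistIm_pi (hF : IsCircleSol k a F) (hG : IsCircleSol k b G) :
    twistIm F G Real.pi = 0 := by
  have h1 : (F Real.pi).im = 0 := hF.pi
  have h2 : (G Real.pi).im = 0 := hG.pi
  simp [twistIm, h1, h2]

end Pair

/-! ### Three integrations by parts -/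

theorem sin_half_pos {x : ℝ} (h0 : 0 < x) (h1 : x ≤ Real.pi) : 0 < Real.sin (x / 2) :=
  Real.sin_pos_of_pos_of_lt_pi (by linarith) (by linarith [Real.pi_pos])

theorem div_pi_le_sin_half {x : ℝ} (h0 : 0 ≤ x) (h1 : x ≤ Real.pi) :
    x / Real.pi ≤ Real.sin (x / 2) := by
  have := Real.mul_le_sin (x := x / 2) (by linarith) (by linarith)
  calc x / Real.pi = 2 / Real.pi * (x / 2) := by ring
    _ ≤ _ := this

theorem hasDerivAt_sin_half (x : ℝ) :
    HasDerivAt (fun x => Real.sin (x / 2)) (Real.cos (x / 2) / 2) x := by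
  have := ((hasDerivAt_id x).div_const 2).sin
  simpa [div_eq_mul_inv] using this

theorem hasDerivAt_cos_half (x : ℝ) :
    HasDerivAt (fun x => Real.cos (x / 2)) (-Real.sin (x / 2) / 2) x := by
  have := ((hasDerivAt_id x).div_const 2).cos
  simpa [div_eq_mul_inv] using this

theorem sin_eq_two_mul_half (x : ℝ) : Real.sin x = 2 * Real.sin (x / 2) * Real.cos (x / 2) := by
  rw [← Real.sin_two_mul]; congr 1; ring

theorem cos_half_pos {x : ℝ} (hx : x ∈ Set.Ioo 0 Real.pi) : 0 < Real.cos (x / 2) :=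
  Real.cos_pos_of_mem_Ioo ⟨by linarith [hx.1, Real.pi_pos], by linarith [hx.2]⟩

theorem abs_integral_le_of_le_div_sq {h : ℝ → ℝ} {ε K : ℝ} (hε : 0 < ε) (hεπ : ε ≤ Real.pi)
    (hK : 0 ≤ K) (hh : ∀ x ∈ Set.Icc ε Real.pi, |h x| ≤ K / Real.sin (x / 2) ^ 2) :
    |∫ x in ε..Real.pi, h x| ≤ K * Real.pi ^ 2 / ε := by
  have hpi := Real.pi_pos
  have hint : ∫ x in ε..Real.pi, K * Real.pi ^ 2 * x ^ (-2 : ℤ) ≤ K * Real.pi ^ 2 / ε := by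
    rw [intervalIntegral.integral_const_mul, integral_zpow]
    · rw [div_eq_mul_inv]
      refine mul_le_mul_of_nonneg_left ?_ (by positivity)
      norm_num
      exact hpi.le
    · refine Or.inr ⟨by norm_num, ?_⟩
      rw [Set.uIcc_of_le hεπ]
      exact fun h => absurd h.1 (not_le.mpr hε)
  refine le_trans ?_ hint
  rw [← Real.norm_eq_abs]
  refine intervalIntegral.norm_integral_le_of_norm_le hεπ (Filter.Eventually.of_forall ?_) ?_
  · intro x hx
    have hx0 : 0 < x := hε.trans hx.1
    refine (hh x ⟨hx.1.le, hx.2⟩).trans ?_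
    have h1 := div_pi_le_sin_half hx0.le hx.2
    have h2 : 0 < x / Real.pi := by positivity
    calc K / Real.sin (x / 2) ^ 2 ≤ K / (x / Real.pi) ^ 2 := by gcongr
      _ = _ := by
        rw [zpow_neg, div_pow]
        field_simp
  · refine ContinuousOn.intervalIntegrable ?_
    rw [Set.uIcc_of_le hεπ]
    refine continuousOn_const.mul (ContinuousOn.zpow₀ continuousOn_id _ fun x hx => Or.inl ?_)
    exact (hε.trans_le hx.1).ne'

/-- The integrand of the kernel on `[0, π]`. For `τ = 1` it is `Im (e^{-ix/2} F conj G)`; for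
`τ = -1` it is the same with `F` and `G` exchanged. -/
def kernelIntegrand (τ : ℝ) (F G : ℝ → ℂ) (x : ℝ) : ℝ :=
  τ * Real.cos (x / 2) * pairIm F G x - Real.sin (x / 2) * pairRe F G x

section Identities

variable {k a b τ ε : ℝ} {F G : ℝ → ℂ}

theorem sin_half_ne_zero (hε : 0 < ε) {x : ℝ} (hx : x ∈ Set.Icc ε Real.pi) :
    Real.sin (x / 2) ≠ 0 := (sin_half_pos (hε.trans_le hx.1) hx.2).ne'

/-- Integration by parts that gains the difference `a - b` of the eigenvalues. At `π` the boundary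
term vanishes, since there `cos (x / 2) = 0` and the solutions are real. -/
theorem integral_kernelIntegrand (hF : IsCircleSol k a F) (hG : IsCircleSol k b G)
    (hτ : τ ^ 2 = 1) (hε : 0 < ε) (hεπ : ε ≤ Real.pi) :
    (a - b - τ / 2) * ∫ x in ε..Real.pi, kernelIntegrand τ F G x =
      τ * (Real.cos (ε / 2) * pairRe F G ε + τ * Real.sin (ε / 2) * pairIm F G ε +
        k * ∫ x in ε..Real.pi, twistRe F G x / Real.sin (x / 2)) := by
  have c1 := hF.continuous_pairRe hG
  have c2 := hF.continuous_pairIm hG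
  have c3 := hF.continuous_twistRe hG
  have cK : Continuous (kernelIntegrand τ F G) := by unfold kernelIntegrand; fun_prop
  have cq : ContinuousOn (fun x => twistRe F G x / Real.sin (x / 2)) (Set.uIcc ε Real.pi) := by
    rw [Set.uIcc_of_le hεπ]
    exact c3.continuousOn.div (Continuous.continuousOn (by fun_prop))
      fun x hx => sin_half_ne_zero hε hx
  have key := intervalIntegral.integral_eq_sub_of_hasDerivAt_of_le
    (f := fun x => Real.cos (x / 2) * pairRe F G x + τ * Real.sin (x / 2) * pairIm F G x)
    (f' := fun x => -τ * (a - b - τ / 2) * kernelIntegrand τ F G x +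
      k * (twistRe F G x / Real.sin (x / 2))) hεπ (Continuous.continuousOn (by fun_prop))
    (fun x hx => ?_)
    ((cK.intervalIntegrable _ _ |>.const_mul _).add (cq.intervalIntegrable.const_mul _))
  · rw [intervalIntegral.integral_add (cK.intervalIntegrable _ _ |>.const_mul _)
      (cq.intervalIntegrable.const_mul _), intervalIntegral.integral_const_mul,
      intervalIntegral.integral_const_mul, hF.pairIm_pi hG, Real.cos_pi_div_two] at key
    linear_combination (-τ) * key - (a - b - τ / 2) *
      (∫ x in ε..Real.pi, kernelIntegrand τ F G x) * hτ
  · have hx0 : x ∈ Set.Ioo 0 Real.pi := ⟨hε.trans hx.1, hx.2⟩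
    have hs := (sin_half_pos hx0.1 hx0.2.le).ne'
    have hc := (cos_half_pos hx0).ne'
    refine (((hasDerivAt_cos_half x).mul (hF.hasDerivAt_pairRe hG hx0)).add
      (((hasDerivAt_sin_half x).const_mul τ).mul (hF.hasDerivAt_pairIm hG hx0))).congr_deriv ?_
    rw [sin_eq_two_mul_half x]
    unfold kernelIntegrand
    field_simp
    linear_combination (Real.sin (x / 2) * (a - b) * 2 * Real.cos (x / 2) * pairIm F G x -
      (-1) * Real.sin (x / 2) ^ 2 * pairRe F G x - τ * Real.sin (x / 2) * Real.cos (x / 2) *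
        pairIm F G x) * hτ

/-- Integration by parts that gains the sum `a + b` of the eigenvalues; the boundary term at `π`
vanishes. -/
theorem integral_twistRe (hF : IsCircleSol k a F) (hG : IsCircleSol k b G)
    (hε : 0 < ε) (hεπ : ε ≤ Real.pi) :
    (a + b - 1) * ∫ x in ε..Real.pi, twistRe F G x / Real.sin (x / 2) =
      -(twistIm F G ε / Real.sin (ε / 2)) +
        1 / 2 * ∫ x in ε..Real.pi,
          twistIm F G x * Real.cos (x / 2) / Real.sin (x / 2) ^ 2 := by
  have c3 := hF.continuous_twistRe hG
  have c4 := hF.continuous_twistIm hG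
  have hs0 : ∀ x ∈ Set.Icc ε Real.pi, Real.sin (x / 2) ≠ 0 := fun x hx => sin_half_ne_zero hε hx
  have cs : ContinuousOn (fun x : ℝ => Real.sin (x / 2)) (Set.Icc ε Real.pi) :=
    Continuous.continuousOn (by fun_prop)
  have i1 : IntervalIntegrable (fun x => twistRe F G x / Real.sin (x / 2))
      MeasureTheory.volume ε Real.pi := by
    apply ContinuousOn.intervalIntegrable
    rw [Set.uIcc_of_le hεπ]
    exact c3.continuousOn.div cs hs0
  have i2 : IntervalIntegrable
      (fun x => twistIm F G x * Real.cos (x / 2) / Real.sin (x / 2) ^ 2)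
      MeasureTheory.volume ε Real.pi := by
    apply ContinuousOn.intervalIntegrable
    rw [Set.uIcc_of_le hεπ]
    exact ContinuousOn.div (Continuous.continuousOn (by fun_prop)) (cs.pow 2)
      fun x hx => pow_ne_zero 2 (hs0 x hx)
  have key := intervalIntegral.integral_eq_sub_of_hasDerivAt_of_le
    (f := fun x => twistIm F G x / Real.sin (x / 2))
    (f' := fun x => (a + b - 1) * (twistRe F G x / Real.sin (x / 2)) -
      1 / 2 * (twistIm F G x * Real.cos (x / 2) / Real.sin (x / 2) ^ 2)) hεπ
    (c4.continuousOn.div cs hs0) (fun x hx => ?_) ((i1.const_mul _).sub (i2.const_mul _))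
  · rw [intervalIntegral.integral_sub (i1.const_mul _) (i2.const_mul _),
      intervalIntegral.integral_const_mul, intervalIntegral.integral_const_mul,
      hF.twistIm_pi hG] at key
    linear_combination key
  · have hx0 : x ∈ Set.Ioo 0 Real.pi := ⟨hε.trans hx.1, hx.2⟩
    have hs := (sin_half_pos hx0.1 hx0.2.le).ne'
    refine ((hF.hasDerivAt_twistIm hG hx0).div (hasDerivAt_sin_half x) hs).congr_deriv ?_
    field_simp

/-- Integration by parts that gains the sum `a + b` of the eigenvalues once more. The singularity
`1 / sin x` of the derivative of `twistRe` at `π` is compensated by the factor `cos (x / 2)`. -/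
theorem integral_twistIm (hF : IsCircleSol k a F) (hG : IsCircleSol k b G)
    (hε : 0 < ε) (hεπ : ε ≤ Real.pi) :
    (a + b - 1) * ∫ x in ε..Real.pi, twistIm F G x * Real.cos (x / 2) / Real.sin (x / 2) ^ 2 =
      twistRe F G ε * Real.cos (ε / 2) / Real.sin (ε / 2) ^ 2 +
        ∫ x in ε..Real.pi, (k * pairRe F G x / Real.sin (x / 2) ^ 3 -
          twistRe F G x * (1 / (2 * Real.sin (x / 2)) +
            Real.cos (x / 2) ^ 2 / Real.sin (x / 2) ^ 3)) := by
  have c1 := hF.continuous_pairRe hG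
  have c3 := hF.continuous_twistRe hG
  have c4 := hF.continuous_twistIm hG
  have hs0 : ∀ x ∈ Set.Icc ε Real.pi, Real.sin (x / 2) ≠ 0 := fun x hx => sin_half_ne_zero hε hx
  have cs : ContinuousOn (fun x : ℝ => Real.sin (x / 2)) (Set.Icc ε Real.pi) :=
    Continuous.continuousOn (by fun_prop)
  have cc : ContinuousOn (fun x : ℝ => Real.cos (x / 2)) (Set.Icc ε Real.pi) :=
    Continuous.continuousOn (by fun_prop)
  have i2 : IntervalIntegrable
      (fun x => twistIm F G x * Real.cos (x / 2) / Real.sin (x / 2) ^ 2)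
      MeasureTheory.volume ε Real.pi := by
    apply ContinuousOn.intervalIntegrable
    rw [Set.uIcc_of_le hεπ]
    exact ContinuousOn.div (Continuous.continuousOn (by fun_prop)) (cs.pow 2)
      fun x hx => pow_ne_zero 2 (hs0 x hx)
  have i3 : IntervalIntegrable
      (fun x => k * pairRe F G x / Real.sin (x / 2) ^ 3 -
          twistRe F G x * (1 / (2 * Real.sin (x / 2)) +
            Real.cos (x / 2) ^ 2 / Real.sin (x / 2) ^ 3))
      MeasureTheory.volume ε Real.pi := by
    apply ContinuousOn.intervalIntegrable
    rw [Set.uIcc_of_le hεπ]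
    have p3 : ∀ x ∈ Set.Icc ε Real.pi, Real.sin (x / 2) ^ 3 ≠ 0 :=
      fun x hx => pow_ne_zero 3 (hs0 x hx)
    refine ((continuousOn_const.mul c1.continuousOn).div (cs.pow 3) p3).sub
      (c3.continuousOn.mul ((continuousOn_const.div (continuousOn_const.mul cs) ?_).add
        ((cc.pow 2).div (cs.pow 3) p3)))
    exact fun x hx => mul_ne_zero two_ne_zero (hs0 x hx)
  have key := intervalIntegral.integral_eq_sub_of_hasDerivAt_of_le
    (f := fun x => twistRe F G x * Real.cos (x / 2) / Real.sin (x / 2) ^ 2)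
    (f' := fun x => (1 - (a + b)) * (twistIm F G x * Real.cos (x / 2) / Real.sin (x / 2) ^ 2) +
      (k * pairRe F G x / Real.sin (x / 2) ^ 3 - twistRe F G x *
        (1 / (2 * Real.sin (x / 2)) + Real.cos (x / 2) ^ 2 / Real.sin (x / 2) ^ 3))) hεπ
    (ContinuousOn.div (Continuous.continuousOn (by fun_prop)) (cs.pow 2)
      fun x hx => pow_ne_zero 2 (hs0 x hx)) (fun x hx => ?_) ((i2.const_mul _).add i3)
  · rw [intervalIntegral.integral_add (i2.const_mul _) i3,
      intervalIntegral.integral_const_mul, Real.cos_pi_div_two] at key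
    linear_combination -key
  · have hx0 : x ∈ Set.Ioo 0 Real.pi := ⟨hε.trans hx.1, hx.2⟩
    have hs := (sin_half_pos hx0.1 hx0.2.le).ne'
    have hc := (cos_half_pos hx0).ne'
    refine (((hF.hasDerivAt_twistRe hG hx0).mul (hasDerivAt_cos_half x)).div
      ((hasDerivAt_sin_half x).pow 2) (pow_ne_zero 2 hs)).congr_deriv ?_
    rw [sin_eq_two_mul_half x]
    simp only [Pi.mul_apply, Pi.pow_apply]
    field_simp
    ring

end Identities

/-! ### Differences of the kernel for neighbouring indices -/

/-- If consecutive multipliers `c` and `c + 1` are inverted, then the difference of the results is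
controlled by the difference of the data and by the size of the second result. -/
theorem abs_sub_le_of_mul_eq {c y₁ y₂ z₁ z₂ S d e : ℝ} (h1 : c * y₁ = z₁) (h2 : (c + 1) * y₂ = z₂)
    (hS : 0 < S) (hc : S ≤ |c|) (hd : |z₂ - z₁| ≤ d) (he : |y₂| ≤ e) :
    |y₂ - y₁| ≤ (d + e) / S := by
  rw [le_div_iff₀ hS]
  have e1 : c * (y₂ - y₁) = z₂ - z₁ - y₂ := by linear_combination h2 - h1
  have h3 : |c| * |y₂ - y₁| ≤ d + e := by
    rw [← abs_mul, e1]
    exact (abs_sub _ _).trans (add_le_add hd he)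
  nlinarith [abs_nonneg (y₂ - y₁)]

theorem abs_le_of_mul_eq {c y z S d : ℝ} (h : c * y = z) (hS : 0 < S) (hc : S ≤ |c|)
    (hd : |z| ≤ d) : |y| ≤ d / S := by
  rw [le_div_iff₀ hS]
  have h3 : |c| * |y| ≤ d := by rwa [← abs_mul, h]
  nlinarith [abs_nonneg y]

/-- The bounds under which the integrals for `F₁` and `F₂` against `G` are compared: the product
with `F₂` is bounded by `M`, and the difference of the products by `M (sin (x / 2) + ε)`. -/
structure PairBound (F₁ F₂ G : ℝ → ℂ) (M ε : ℝ) : Prop where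
  right : ∀ x ∈ Set.Icc 0 Real.pi, ‖F₂ x‖ * ‖G x‖ ≤ M
  diff : ∀ x ∈ Set.Icc 0 Real.pi, ‖(F₂ - F₁) x‖ * ‖G x‖ ≤ M * (Real.sin (x / 2) + ε)

section Estimates

variable {k a b τ M N S D : ℝ} {F₁ F₂ G : ℝ → ℂ}

/-- The integral of `twistIm F G x * cos (x / 2) / sin (x / 2) ^ 2` over `[ε, π]`. -/
def intTwistIm (F G : ℝ → ℂ) (ε : ℝ) : ℝ :=
  ∫ x in ε..Real.pi, twistIm F G x * Real.cos (x / 2) / Real.sin (x / 2) ^ 2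

/-- The integral of `twistRe F G x / sin (x / 2)` over `[ε, π]`. -/
def intTwistRe (F G : ℝ → ℂ) (ε : ℝ) : ℝ :=
  ∫ x in ε..Real.pi, twistRe F G x / Real.sin (x / 2)

/-- On `[1 / N, π]` the term `1 / N` is dominated by `sin (x / 2)`. -/
theorem PairBound.diff_le (h : PairBound F₁ F₂ G M N⁻¹) (hM : 0 ≤ M) (hN : 1 ≤ N) {x : ℝ}
    (hx : x ∈ Set.Icc N⁻¹ Real.pi) :
    ‖(F₂ - F₁) x‖ * ‖G x‖ ≤ 5 * M * Real.sin (x / 2) := by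
  have hN0 : 0 < N⁻¹ := by positivity
  have hx0 : 0 ≤ x := hN0.le.trans hx.1
  refine (h.diff x ⟨hx0, hx.2⟩).trans ?_
  have h1 := div_pi_le_sin_half hx0 hx.2
  rw [div_le_iff₀ Real.pi_pos] at h1
  have h2 : N⁻¹ ≤ 4 * Real.sin (x / 2) := by
    have h3 := sin_half_pos (hN0.trans_le hx.1) hx.2
    nlinarith [Real.pi_le_four, hx.1]
  nlinarith

theorem inv_sin_half_le (hN : 1 ≤ N) : 1 / Real.sin (N⁻¹ / 2) ≤ 4 * N := by
  have hN0 : 0 < N⁻¹ := by positivity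
  have hN1 : N⁻¹ ≤ Real.pi := (inv_le_one_of_one_le₀ hN).trans (by linarith [Real.pi_gt_three])
  have h1 := div_pi_le_sin_half hN0.le hN1
  have h2 : N⁻¹ / 4 ≤ Real.sin (N⁻¹ / 2) :=
    le_trans (by gcongr; exact Real.pi_le_four) h1
  calc 1 / Real.sin (N⁻¹ / 2) ≤ 1 / (N⁻¹ / 4) := by gcongr
    _ = _ := by field_simp

theorem PairBound.intTwistIm_right_le (h : PairBound F₁ F₂ G M N⁻¹) (hM : 0 ≤ M) (hN : 1 ≤ N) :
    |intTwistIm F₂ G N⁻¹| ≤ 16 * M * N := by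
  have hN0 : 0 < N⁻¹ := by positivity
  have hN1 : N⁻¹ ≤ Real.pi := (inv_le_one_of_one_le₀ hN).trans (by linarith [Real.pi_gt_three])
  have h1 := abs_integral_le_of_le_div_sq (h := fun x =>
    twistIm F₂ G x * Real.cos (x / 2) / Real.sin (x / 2) ^ 2) hN0 hN1 hM (fun x hx => ?_)
  · refine h1.trans ?_
    rw [div_inv_eq_mul]
    have : Real.pi ^ 2 ≤ 16 := by nlinarith [Real.pi_pos, Real.pi_le_four]
    nlinarith [mul_nonneg hM (by linarith : 0 ≤ N)]
  · have hx0 : x ∈ Set.Icc 0 Real.pi := ⟨hN0.le.trans hx.1, hx.2⟩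
    rw [abs_div, abs_of_nonneg (sq_nonneg (Real.sin (x / 2))), abs_mul]
    gcongr
    have h2 := (abs_twistIm_le F₂ G x).trans (h.right x hx0)
    calc _ ≤ M * 1 := mul_le_mul h2 (Real.abs_cos_le_one _) (abs_nonneg _) hM
      _ = M := mul_one M

theorem PairBound.intTwistIm_sub_le (h : PairBound F₁ F₂ G M N⁻¹) (hk : 0 ≤ k)
    (h₁ : IsCircleSol k a F₁) (h₂ : IsCircleSol k (a + 1) F₂) (hG : IsCircleSol k b G)
    (hM : 0 ≤ M) (hN : 1 ≤ N) (hS : 0 < S) (hS1 : S ≤ |a + b - 1|) :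
    |intTwistIm F₂ G N⁻¹ - intTwistIm F₁ G N⁻¹| ≤ (200 + 80 * k) * M * N / S := by
  have hN0 : 0 < N⁻¹ := by positivity
  have hN1 : N⁻¹ ≤ Real.pi := (inv_le_one_of_one_le₀ hN).trans (by linarith [Real.pi_gt_three])
  have e1 := integral_twistIm h₁ hG hN0 hN1
  have e2 := integral_twistIm h₂ hG hN0 hN1
  rw [show a + 1 + b - 1 = (a + b - 1) + 1 by ring] at e2
  set ε := N⁻¹ with hε
  have hpi2 : Real.pi ^ 2 ≤ 16 := by nlinarith [Real.pi_pos, Real.pi_le_four]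
  have hbd : |twistRe F₂ G ε * Real.cos (ε / 2) / Real.sin (ε / 2) ^ 2 -
      twistRe F₁ G ε * Real.cos (ε / 2) / Real.sin (ε / 2) ^ 2| ≤ 20 * M * N := by
    have hs := sin_half_pos hN0 hN1
    have h1 : |twistRe F₂ G ε - twistRe F₁ G ε| ≤ 5 * M * Real.sin (ε / 2) := by
      rw [twistRe_sub]
      exact (abs_twistRe_le _ _ _).trans (h.diff_le hM hN ⟨le_rfl, hN1⟩)
    rw [← sub_div, ← sub_mul, abs_div, abs_mul, abs_of_pos (pow_pos hs 2)]
    calc _ ≤ 5 * M * Real.sin (ε / 2) * 1 / Real.sin (ε / 2) ^ 2 := by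
          gcongr; exact Real.abs_cos_le_one _
      _ = 5 * M * (1 / Real.sin (ε / 2)) := by field_simp
      _ ≤ 5 * M * (4 * N) := by gcongr; exact inv_sin_half_le hN
      _ = _ := by ring
  have cont : ∀ {c : ℝ} {F : ℝ → ℂ}, IsCircleSol k c F → IntervalIntegrable
      (fun x => k * pairRe F G x / Real.sin (x / 2) ^ 3 -
          twistRe F G x * (1 / (2 * Real.sin (x / 2)) +
            Real.cos (x / 2) ^ 2 / Real.sin (x / 2) ^ 3))
      MeasureTheory.volume ε Real.pi := by
    intro c F hF
    have c1 := hF.continuous_pairRe hG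
    have c3 := hF.continuous_twistRe hG
    apply ContinuousOn.intervalIntegrable
    rw [Set.uIcc_of_le hN1]
    have hs0 : ∀ x ∈ Set.Icc ε Real.pi, Real.sin (x / 2) ≠ 0 :=
      fun x hx => sin_half_ne_zero hN0 hx
    have p3 : ∀ x ∈ Set.Icc ε Real.pi, Real.sin (x / 2) ^ 3 ≠ 0 :=
      fun x hx => pow_ne_zero 3 (hs0 x hx)
    have cs : ContinuousOn (fun x : ℝ => Real.sin (x / 2)) (Set.Icc ε Real.pi) :=
      Continuous.continuousOn (by fun_prop)
    have cc : ContinuousOn (fun x : ℝ => Real.cos (x / 2)) (Set.Icc ε Real.pi) :=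
      Continuous.continuousOn (by fun_prop)
    refine ((continuousOn_const.mul c1.continuousOn).div (cs.pow 3) p3).sub
      (c3.continuousOn.mul ((continuousOn_const.div (continuousOn_const.mul cs) ?_).add
        ((cc.pow 2).div (cs.pow 3) p3)))
    exact fun x hx => mul_ne_zero two_ne_zero (hs0 x hx)
  have hint : |(∫ x in ε..Real.pi, (k * pairRe F₂ G x / Real.sin (x / 2) ^ 3 -
          twistRe F₂ G x * (1 / (2 * Real.sin (x / 2)) +
            Real.cos (x / 2) ^ 2 / Real.sin (x / 2) ^ 3))) -
      ∫ x in ε..Real.pi, (k * pairRe F₁ G x / Real.sin (x / 2) ^ 3 -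
          twistRe F₁ G x * (1 / (2 * Real.sin (x / 2)) +
            Real.cos (x / 2) ^ 2 / Real.sin (x / 2) ^ 3))| ≤ (120 + 80 * k) * M * N := by
    rw [← intervalIntegral.integral_sub (cont h₂) (cont h₁)]
    have h1 := abs_integral_le_of_le_div_sq (K := 5 * (k + 3 / 2) * M) hN0 hN1 (by positivity)
      (h := fun x => (k * pairRe F₂ G x / Real.sin (x / 2) ^ 3 -
          twistRe F₂ G x * (1 / (2 * Real.sin (x / 2)) +
            Real.cos (x / 2) ^ 2 / Real.sin (x / 2) ^ 3)) -
        (k * pairRe F₁ G x / Real.sin (x / 2) ^ 3 -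
          twistRe F₁ G x * (1 / (2 * Real.sin (x / 2)) +
            Real.cos (x / 2) ^ 2 / Real.sin (x / 2) ^ 3))) (fun x hx => ?_)
    · refine h1.trans ?_
      rw [hε, div_inv_eq_mul]
      have : 0 ≤ (k + 3 / 2) * M * N := by positivity
      nlinarith
    · have hs := sin_half_pos (hN0.trans_le hx.1) hx.2
      have hd := h.diff_le hM hN hx
      have hP : |pairRe F₂ G x - pairRe F₁ G x| ≤ 5 * M * Real.sin (x / 2) := by
        rw [pairRe_sub]
        exact (abs_pairRe_le _ _ _).trans hd
      have hT : |twistRe F₂ G x - twistRe F₁ G x| ≤ 5 * M * Real.sin (x / 2) := by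
        rw [twistRe_sub]
        exact (abs_twistRe_le _ _ _).trans hd
      have hs1 := Real.sin_le_one (x / 2)
      have hcoef : 1 / (2 * Real.sin (x / 2)) + Real.cos (x / 2) ^ 2 / Real.sin (x / 2) ^ 3 ≤
          3 / 2 / Real.sin (x / 2) ^ 3 := by
        rw [div_add_div _ _ (by positivity) (by positivity),
          div_le_div_iff₀ (by positivity) (by positivity)]
        have hc := Real.cos_sq_le_one (x / 2)
        have h2 : Real.sin (x / 2) ^ 3 ≤ Real.sin (x / 2) := by
          have : Real.sin (x / 2) ^ 2 ≤ 1 := by nlinarith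
          nlinarith
        have h3 : 0 < Real.sin (x / 2) ^ 3 := by positivity
        nlinarith [mul_le_mul_of_nonneg_right h2 h3.le,
          mul_le_mul_of_nonneg_right hc (mul_pos hs h3).le]
      have hcoef0 : 0 ≤ 1 / (2 * Real.sin (x / 2)) +
          Real.cos (x / 2) ^ 2 / Real.sin (x / 2) ^ 3 := by positivity
      have e : (k * pairRe F₂ G x / Real.sin (x / 2) ^ 3 -
          twistRe F₂ G x * (1 / (2 * Real.sin (x / 2)) +
            Real.cos (x / 2) ^ 2 / Real.sin (x / 2) ^ 3)) -
        (k * pairRe F₁ G x / Real.sin (x / 2) ^ 3 -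
          twistRe F₁ G x * (1 / (2 * Real.sin (x / 2)) +
            Real.cos (x / 2) ^ 2 / Real.sin (x / 2) ^ 3)) =
        k / Real.sin (x / 2) ^ 3 * (pairRe F₂ G x - pairRe F₁ G x) -
          (1 / (2 * Real.sin (x / 2)) + Real.cos (x / 2) ^ 2 / Real.sin (x / 2) ^ 3) *
            (twistRe F₂ G x - twistRe F₁ G x) := by ring
      rw [e]
      refine (abs_sub _ _).trans ?_
      rw [abs_mul, abs_mul, abs_of_nonneg hcoef0, abs_of_nonneg (by positivity)]
      calc _ ≤ k / Real.sin (x / 2) ^ 3 * (5 * M * Real.sin (x / 2)) +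
            3 / 2 / Real.sin (x / 2) ^ 3 * (5 * M * Real.sin (x / 2)) := by gcongr
        _ = _ := by field_simp
  have h3 := abs_sub_le_of_mul_eq (S := S) (d := 20 * M * N + (120 + 80 * k) * M * N)
    (e := 16 * M * N) e1 e2 hS hS1 ?_ (h.intTwistIm_right_le hM hN)
  · refine h3.trans ?_
    gcongr
    have : 0 ≤ M * N := by positivity
    nlinarith
  · rw [add_sub_add_comm]
    exact (abs_add_le _ _).trans (add_le_add hbd hint)

theorem PairBound.abs_twistIm_div_le (h : PairBound F₁ F₂ G M N⁻¹) (hM : 0 ≤ M) (hN : 1 ≤ N) :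
    |twistIm F₂ G N⁻¹ / Real.sin (N⁻¹ / 2)| ≤ 4 * M * N := by
  have hN0 : 0 < N⁻¹ := by positivity
  have hN1 : N⁻¹ ≤ Real.pi := (inv_le_one_of_one_le₀ hN).trans (by linarith [Real.pi_gt_three])
  have hs := sin_half_pos hN0 hN1
  rw [abs_div, abs_of_pos hs, div_eq_mul_one_div]
  calc _ ≤ M * (4 * N) := mul_le_mul ((abs_twistIm_le _ _ _).trans (h.right _ ⟨hN0.le, hN1⟩))
        (inv_sin_half_le hN) (by positivity) hM
    _ = _ := by ring

theorem PairBound.intTwistRe_right_le (h : PairBound F₁ F₂ G M N⁻¹)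
    (h₂ : IsCircleSol k (a + 1) F₂) (hG : IsCircleSol k b G)
    (hM : 0 ≤ M) (hN : 1 ≤ N) (hS : 0 < S) (hS2 : S ≤ |a + b|) :
    |intTwistRe F₂ G N⁻¹| ≤ 12 * M * N / S := by
  have hN0 : 0 < N⁻¹ := by positivity
  have hN1 : N⁻¹ ≤ Real.pi := (inv_le_one_of_one_le₀ hN).trans (by linarith [Real.pi_gt_three])
  have e2 := integral_twistRe h₂ hG hN0 hN1
  rw [show a + 1 + b - 1 = a + b by ring] at e2
  refine abs_le_of_mul_eq e2 hS hS2 ?_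
  refine (abs_add_le _ _).trans ?_
  have h1 := h.intTwistIm_right_le hM hN
  have h2 := h.abs_twistIm_div_le hM hN
  unfold intTwistIm at h1
  rw [abs_neg, abs_mul, abs_of_pos (by norm_num : (0 : ℝ) < 1 / 2)]
  linarith

theorem PairBound.intTwistRe_sub_le (h : PairBound F₁ F₂ G M N⁻¹) (hk : 0 ≤ k)
    (h₁ : IsCircleSol k a F₁) (h₂ : IsCircleSol k (a + 1) F₂) (hG : IsCircleSol k b G)
    (hM : 0 ≤ M) (hN : 1 ≤ N) (hS : 0 < S) (hSN : S ≤ N) (hS1 : S ≤ |a + b - 1|)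
    (hS2 : S ≤ |a + b|) :
    |intTwistRe F₂ G N⁻¹ - intTwistRe F₁ G N⁻¹| ≤ (117 + 40 * k) * M * N / S ^ 2 := by
  have hN0 : 0 < N⁻¹ := by positivity
  have hN1 : N⁻¹ ≤ Real.pi := (inv_le_one_of_one_le₀ hN).trans (by linarith [Real.pi_gt_three])
  have hs := sin_half_pos hN0 hN1
  have e1 := integral_twistRe h₁ hG hN0 hN1
  have e2 := integral_twistRe h₂ hG hN0 hN1
  rw [show a + 1 + b - 1 = (a + b - 1) + 1 by ring] at e2
  have h1 := h.intTwistRe_right_le h₂ hG hM hN hS hS2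
  have h2 := h.intTwistIm_sub_le hk h₁ h₂ hG hM hN hS hS1
  have h3 : |twistIm F₂ G N⁻¹ / Real.sin (N⁻¹ / 2) - twistIm F₁ G N⁻¹ / Real.sin (N⁻¹ / 2)| ≤
      5 * M := by
    rw [← sub_div, twistIm_sub, abs_div, abs_of_pos hs, div_le_iff₀ hs]
    exact (abs_twistIm_le _ _ _).trans (h.diff_le hM hN ⟨le_rfl, hN1⟩)
  have h4 : 5 * M ≤ 5 * M * N / S := by
    rw [le_div_iff₀ hS]
    gcongr
  have h5 := abs_sub_le_of_mul_eq (S := S) (d := 5 * M * N / S +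
    1 / 2 * ((200 + 80 * k) * M * N / S)) e1 e2 hS hS1 ?_ h1
  · refine h5.trans (le_of_eq ?_)
    field_simp
    ring
  · unfold intTwistIm at h2
    rw [show ∀ p q r s : ℝ, -p + 1 / 2 * q - (-r + 1 / 2 * s) = -(p - r) + 1 / 2 * (q - s) by
      intros; ring]
    refine (abs_add_le _ _).trans ?_
    rw [abs_neg, abs_mul, abs_of_pos (by norm_num : (0 : ℝ) < 1 / 2)]
    gcongr
    exact h3.trans h4

theorem abs_kernelIntegrand_le (hτ : τ ^ 2 = 1) (F G : ℝ → ℂ) (x : ℝ) :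
    |kernelIntegrand τ F G x| ≤ 2 * (‖F x‖ * ‖G x‖) := by
  have hτ1 : |τ| = 1 :=
    (pow_eq_one_iff_of_nonneg (abs_nonneg τ) two_ne_zero).mp (by rw [sq_abs, hτ])
  unfold kernelIntegrand
  refine (abs_sub _ _).trans ?_
  rw [abs_mul, abs_mul, abs_mul, hτ1, two_mul, one_mul]
  refine add_le_add ?_ ?_
  · exact (mul_le_of_le_one_left (abs_nonneg _) (Real.abs_cos_le_one _)).trans
      (abs_pairIm_le _ _ _)
  · exact (mul_le_of_le_one_left (abs_nonneg _) (Real.abs_sin_le_one _)).trans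
      (abs_pairRe_le _ _ _)

theorem kernelIntegrand_sub (τ : ℝ) (F F' G : ℝ → ℂ) (x : ℝ) :
    kernelIntegrand τ F G x - kernelIntegrand τ F' G x = kernelIntegrand τ (F - F') G x := by
  unfold kernelIntegrand
  rw [← pairRe_sub, ← pairIm_sub]; ring

theorem IsCircleSol.continuous_kernelIntegrand (τ : ℝ) {F : ℝ → ℂ} (hF : IsCircleSol k a F)
    (hG : IsCircleSol k b G) : Continuous (kernelIntegrand τ F G) := by
  have c1 := hF.continuous_pairRe hG
  have c2 := hF.continuous_pairIm hG
  unfold kernelIntegrand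
  fun_prop

/-- The part of the kernel away from `0`. The singular integrals over `[1 / N, π]` are at most of
order `N` times the gain of the integrations by parts. -/
theorem PairBound.outer_sub_le (h : PairBound F₁ F₂ G M N⁻¹) (hk : 0 ≤ k) (hτ : τ ^ 2 = 1)
    (h₁ : IsCircleSol k a F₁) (h₂ : IsCircleSol k (a + 1) F₂) (hG : IsCircleSol k b G)
    (hM : 0 ≤ M) (hN : 1 ≤ N) (hS : 0 < S) (hSN : S ≤ N) (hS1 : S ≤ |a + b - 1|)
    (hS2 : S ≤ |a + b|) (hD : 0 < D) (hD1 : D ≤ |a - b - τ / 2|)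
    (hD2 : D ≤ |a + 1 - b - τ / 2|) :
    |(∫ x in N⁻¹..Real.pi, kernelIntegrand τ F₂ G x) -
      ∫ x in N⁻¹..Real.pi, kernelIntegrand τ F₁ G x| ≤
      (5 + 117 * k + 40 * k ^ 2) * M * (N / (S ^ 2 * D)) +
        (2 + 12 * k) * M * (N / (S * D ^ 2)) := by
  have hN0 : 0 < N⁻¹ := by positivity
  have hN1 : N⁻¹ ≤ Real.pi := (inv_le_one_of_one_le₀ hN).trans (by linarith [Real.pi_gt_three])
  have hNpos : 0 < N := by positivity
  have hs := sin_half_pos hN0 hN1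
  have hτ1 : |τ| = 1 :=
    (pow_eq_one_iff_of_nonneg (abs_nonneg τ) two_ne_zero).mp (by rw [sq_abs, hτ])
  have e1 := integral_kernelIntegrand h₁ hG hτ hN0 hN1
  have e2 := integral_kernelIntegrand h₂ hG hτ hN0 hN1
  have q2 := h.intTwistRe_right_le h₂ hG hM hN hS hS2
  have qd := h.intTwistRe_sub_le hk h₁ h₂ hG hM hN hS hSN hS1 hS2
  unfold intTwistRe at q2 qd
  have hbd : ∀ F : ℝ → ℂ, ∀ B : ℝ, ‖F N⁻¹‖ * ‖G N⁻¹‖ ≤ B →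
      |Real.cos (N⁻¹ / 2) * pairRe F G N⁻¹ + τ * Real.sin (N⁻¹ / 2) * pairIm F G N⁻¹| ≤ 2 * B := by
    intro F B hB
    refine (abs_add_le _ _).trans ?_
    rw [abs_mul, abs_mul, abs_mul, hτ1, two_mul, one_mul]
    refine add_le_add ?_ ?_
    · exact (mul_le_of_le_one_left (abs_nonneg _) (Real.abs_cos_le_one _)).trans
        ((abs_pairRe_le _ _ _).trans hB)
    · exact (mul_le_of_le_one_left (abs_nonneg _) (Real.abs_sin_le_one _)).trans
        ((abs_pairIm_le _ _ _).trans hB)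
  have hI2 : |∫ x in N⁻¹..Real.pi, kernelIntegrand τ F₂ G x| ≤
      (2 + 12 * k) * M * N / S / D := by
    refine abs_le_of_mul_eq e2 hD hD2 ?_
    rw [abs_mul, hτ1, one_mul]
    refine (abs_add_le _ _).trans ?_
    have h1 := hbd F₂ M (h.right _ ⟨hN0.le, hN1⟩)
    have h2 : 2 * M ≤ 2 * M * N / S := by
      rw [le_div_iff₀ hS]; gcongr
    rw [abs_mul, abs_of_nonneg hk]
    calc _ ≤ 2 * M * N / S + k * (12 * M * N / S) := by
          gcongr
          exact h1.trans h2
      _ = _ := by ring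
  have hdiff : |(∫ x in N⁻¹..Real.pi, kernelIntegrand τ F₂ G x) -
      ∫ x in N⁻¹..Real.pi, kernelIntegrand τ F₁ G x| ≤
      ((5 + 117 * k + 40 * k ^ 2) * M * N / S ^ 2 + (2 + 12 * k) * M * N / S / D) / D := by
    rw [show a + 1 - b - τ / 2 = (a - b - τ / 2) + 1 by ring] at e2
    refine abs_sub_le_of_mul_eq e1 e2 hD hD1 ?_ hI2
    rw [← mul_sub, abs_mul, hτ1, one_mul]
    have h1 := hbd (F₂ - F₁) (5 * M * Real.sin (N⁻¹ / 2)) (h.diff_le hM hN ⟨le_rfl, hN1⟩)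
    rw [← pairRe_sub, ← pairIm_sub] at h1
    have h2 : 2 * (5 * M * Real.sin (N⁻¹ / 2)) ≤ 5 * M * N / S ^ 2 := by
      have h3 : Real.sin (N⁻¹ / 2) ≤ N⁻¹ / 2 := Real.sin_le (by positivity)
      have h4 : N⁻¹ ≤ N / S ^ 2 := by
        rw [le_div_iff₀ (by positivity), inv_mul_le_iff₀ hNpos]
        nlinarith
      calc _ ≤ 2 * (5 * M * (N / S ^ 2 / 2)) := by gcongr; linarith
        _ = _ := by ring
    calc _ = |(Real.cos (N⁻¹ / 2) * (pairRe F₂ G N⁻¹ - pairRe F₁ G N⁻¹) +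
            τ * Real.sin (N⁻¹ / 2) * (pairIm F₂ G N⁻¹ - pairIm F₁ G N⁻¹)) +
          k * ((∫ x in N⁻¹..Real.pi, twistRe F₂ G x / Real.sin (x / 2)) -
            ∫ x in N⁻¹..Real.pi, twistRe F₁ G x / Real.sin (x / 2))| := by congr 1; ring
      _ ≤ 5 * M * N / S ^ 2 + k * ((117 + 40 * k) * M * N / S ^ 2) := by
          refine (abs_add_le _ _).trans (add_le_add (h1.trans h2) ?_)
          rw [abs_mul, abs_of_nonneg hk]
          gcongr
      _ = _ := by ring
  refine hdiff.trans (le_of_eq ?_)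
  field_simp

/-- On `[0, 1 / N]` the integrands differ by a multiple of `1 / N`, so this part contributes the
term `1 / N ^ 2`. -/
theorem PairBound.integral_kernelIntegrand_sub_le (h : PairBound F₁ F₂ G M N⁻¹) (hk : 0 ≤ k)
    (hτ : τ ^ 2 = 1)
    (h₁ : IsCircleSol k a F₁) (h₂ : IsCircleSol k (a + 1) F₂) (hG : IsCircleSol k b G)
    (hM : 0 ≤ M) (hN : 1 ≤ N) (hS : 0 < S) (hSN : S ≤ N) (hS1 : S ≤ |a + b - 1|)
    (hS2 : S ≤ |a + b|) (hD : 0 < D) (hD1 : D ≤ |a - b - τ / 2|)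
    (hD2 : D ≤ |a + 1 - b - τ / 2|) :
    |(∫ x in (0 : ℝ)..Real.pi, kernelIntegrand τ F₂ G x) -
      ∫ x in (0 : ℝ)..Real.pi, kernelIntegrand τ F₁ G x| ≤
      (5 + 117 * k + 40 * k ^ 2) * M *
        (1 / N ^ 2 + N / (S ^ 2 * D) + N / (S * D ^ 2)) := by
  have hN0 : 0 < N⁻¹ := by positivity
  have hN1 : N⁻¹ ≤ Real.pi := (inv_le_one_of_one_le₀ hN).trans (by linarith [Real.pi_gt_three])
  have hNpos : 0 < N := by positivity
  have c1 := h₁.continuous_kernelIntegrand τ hG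
  have c2 := h₂.continuous_kernelIntegrand τ hG
  have hout := h.outer_sub_le hk hτ h₁ h₂ hG hM hN hS hSN hS1 hS2 hD hD1 hD2
  have hin : |∫ x in (0 : ℝ)..N⁻¹, (kernelIntegrand τ F₂ G x - kernelIntegrand τ F₁ G x)| ≤
      3 * M * (1 / N ^ 2) := by
    have := intervalIntegral.norm_integral_le_of_norm_le_const (a := 0) (b := N⁻¹)
      (C := 3 * M * N⁻¹)
      (f := fun x => kernelIntegrand τ F₂ G x - kernelIntegrand τ F₁ G x) (fun x hx => ?_)
    · rw [Real.norm_eq_abs, sub_zero, abs_of_pos hN0] at this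
      refine this.trans (le_of_eq ?_)
      field_simp
    · rw [Set.uIoc_of_le hN0.le] at hx
      rw [Real.norm_eq_abs, kernelIntegrand_sub]
      refine (abs_kernelIntegrand_le hτ _ _ _).trans ?_
      have h1 := h.diff x ⟨hx.1.le, hx.2.trans hN1⟩
      have h2 : Real.sin (x / 2) ≤ x / 2 := Real.sin_le (by linarith [hx.1])
      have h3 : M * (Real.sin (x / 2) + N⁻¹) ≤ M * (3 / 2 * N⁻¹) := by
        gcongr
        linarith [hx.2]
      linarith
  have hsplit : (∫ x in (0 : ℝ)..Real.pi, kernelIntegrand τ F₂ G x) -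
      ∫ x in (0 : ℝ)..Real.pi, kernelIntegrand τ F₁ G x =
      (∫ x in (0 : ℝ)..N⁻¹, (kernelIntegrand τ F₂ G x - kernelIntegrand τ F₁ G x)) +
      ((∫ x in N⁻¹..Real.pi, kernelIntegrand τ F₂ G x) -
        ∫ x in N⁻¹..Real.pi, kernelIntegrand τ F₁ G x) := by
    rw [intervalIntegral.integral_sub (c2.intervalIntegrable _ _) (c1.intervalIntegrable _ _),
      ← intervalIntegral.integral_add_adjacent_intervals (b := N⁻¹)
        (c2.intervalIntegrable 0 N⁻¹) (c2.intervalIntegrable N⁻¹ Real.pi),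
      ← intervalIntegral.integral_add_adjacent_intervals (b := N⁻¹)
        (c1.intervalIntegrable 0 N⁻¹) (c1.intervalIntegrable N⁻¹ Real.pi)]
    ring
  rw [hsplit]
  refine (abs_add_le _ _).trans ((add_le_add hin hout).trans ?_)
  have t1 : 0 ≤ M * (1 / N ^ 2) := by positivity
  have t2 : 0 ≤ M * (N / (S * D ^ 2)) := by positivity
  nlinarith [mul_nonneg hk t1, mul_nonneg hk t2, mul_nonneg (sq_nonneg k) t1,
    mul_nonneg (sq_nonneg k) t2]

end Estimates

/-! ### The Riesz kernel -/

/-- The Riesz kernel up to the factor `1 / π`: for `τ = 1` with `m` as its second index, for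
`τ = -1` with `m` as its first. -/
def halfKernel (k τ : ℝ) (m n : ℤ) : ℝ :=
  ∫ x in (0 : ℝ)..Real.pi, kernelIntegrand τ (circleFun k m) (circleFun k n) x

theorem kernelIntegrand_swap (F G : ℝ → ℂ) : kernelIntegrand 1 G F = kernelIntegrand (-1) F G := by
  funext x
  simp only [kernelIntegrand, pairIm, pairRe]
  ring

theorem halfKernel_swap (k : ℝ) (m n : ℤ) : halfKernel k 1 n m = halfKernel k (-1) m n := by
  unfold halfKernel
  rw [kernelIntegrand_swap]

theorem kernelIntegrand_one_eq_im (F G : ℝ → ℂ) (x : ℝ) :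
    kernelIntegrand 1 F G x =
      (Complex.exp (-(Complex.I * x / 2)) * (F x * (starRingEnd ℂ) (G x))).im := by
  have h : -(Complex.I * x / 2) = (-(x / 2) : ℝ) * Complex.I := by push_cast; ring
  rw [h, Complex.exp_mul_I, ← Complex.ofReal_cos, ← Complex.ofReal_sin, Real.cos_neg,
    Real.sin_neg]
  unfold kernelIntegrand pairRe pairIm
  generalize Real.cos (x / 2) = c
  generalize Real.sin (x / 2) = s
  simp
  ring

theorem rieszKernel_eq_halfKernel (k : ℝ≥0) (n m : ℤ) :
    rieszKernel k n m = ((1 / Real.pi * halfKernel k 1 m n : ℝ) : ℂ) := by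
  unfold rieszKernel
  have hN : ∀ (j : ℤ) (z : ℂ), normOpdamPoly k j z =
      explicitPoly k j z / (Real.sqrt (sqNorm k j) : ℂ) := by
    intro j z
    unfold normOpdamPoly
    rw [ipNorm_opdamPoly, opdamPoly_eq_explicitPoly]
  set f : ℝ → ℂ := fun x => Complex.exp (-(Complex.I * (x : ℂ) / 2)) *
    normOpdamPoly k m (Complex.I * (x : ℂ)) * normOpdamPoly k n (-(Complex.I * (x : ℂ))) *
      (weight k x : ℂ) with hf
  have hf' : ∀ x, f x = Complex.exp (-(Complex.I * (x : ℂ) / 2)) *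
      (explicitPoly k m (Complex.I * x) / (Real.sqrt (sqNorm k m) : ℂ)) *
      ((starRingEnd ℂ) (explicitPoly k n (Complex.I * x)) / (Real.sqrt (sqNorm k n) : ℂ)) *
      (weight k x : ℂ) := by
    intro x
    rw [hf]
    simp only [hN, onCircle_explicitPoly_neg]
  have hcf : Continuous f := by
    have c1 := continuous_explicitPoly_I_mul k m
    have c2 := continuous_explicitPoly_I_mul k n
    have c3 := continuous_weight k
    rw [funext hf']
    fun_prop
  have hsym : ∀ x, (fun x => -Complex.I * f x) (2 * Real.pi - x) =
      (starRingEnd ℂ) ((fun x => -Complex.I * f x) x) := by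
    intro x
    have hexp : Complex.exp (-(Complex.I * ((2 * Real.pi - x : ℝ) : ℂ) / 2)) =
        -(starRingEnd ℂ) (Complex.exp (-(Complex.I * (x : ℂ) / 2))) := by
      rw [← Complex.exp_conj]
      have : -(Complex.I * ((2 * Real.pi - x : ℝ) : ℂ) / 2) =
          (starRingEnd ℂ) (-(Complex.I * (x : ℂ) / 2)) - Real.pi * Complex.I := by
        simp only [map_neg, map_div₀, map_mul, Complex.conj_I, Complex.conj_ofReal, map_ofNat]
        push_cast
        ring
      rw [this, Complex.exp_sub_pi_mul_I]
    simp only [hf', hexp, onCircle_explicitPoly_two_pi_sub, weight_two_pi_sub]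
    simp
  have hint := integral_circle_eq_re (f := fun x => -Complex.I * f x) (by fun_prop) hsym
  rw [intervalIntegral.integral_const_mul] at hint
  have him : ∫ x in (0 : ℝ)..Real.pi, (-Complex.I * f x).re = halfKernel k 1 m n := by
    unfold halfKernel
    refine intervalIntegral.integral_congr fun x hx => ?_
    rw [Set.uIcc_of_le Real.pi_pos.le] at hx
    have hw := halfWeight_sq k (Real.sin_nonneg_of_mem_Icc hx)
    simp only [kernelIntegrand_one_eq_im, hf', circleFun, ← hw]
    rw [show ∀ z : ℂ, (-Complex.I * z).re = z.im by intro z; simp]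
    congr 1
    rw [map_mul, Complex.conj_ofReal]
    push_cast
    ring
  rw [him] at hint
  have hpi : (Real.pi : ℂ) ≠ 0 := by exact_mod_cast Real.pi_pos.ne'
  have hI := Complex.I_sq
  have hI0 := Complex.I_ne_zero
  have e : (∫ x in (0 : ℝ)..(2 * Real.pi), f x) =
      Complex.I * ((2 * halfKernel k 1 m n : ℝ) : ℂ) := by
    rw [← hint]
    linear_combination (∫ x in (0 : ℝ)..(2 * Real.pi), f x) * hI
  rw [e]
  push_cast
  field_simp

theorem spectralValue_add_one (k : ℝ) {m : ℤ} (hm : 0 < m ∨ m < -1) :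
    spectralValue k (m + 1) = spectralValue k m + 1 := by
  unfold spectralValue
  split_ifs <;> first | omega | (push_cast; ring)

theorem le_abs_sub_of_le_abs {r y t : ℝ} (hr : 2 ≤ r) (hy : r ≤ |y|) (ht : |t| ≤ 1) :
    r / 2 ≤ |y - t| := by
  have := abs_sub_abs_le_abs_sub y t
  linarith

/-- Lower bounds for the sum and for the difference of the eigenvalues of `E_m` (or `E_{m+1}`) and
`E_n`. One of the two is at least `|n|`, the sum if `m` and `n` have the same sign and the
difference otherwise; the other one is at least `r / 2`. -/
theorem exists_gaps {k : ℝ} (hk : 0 ≤ k) {τ : ℝ} (hτ : |τ| = 1) {n m : ℤ} {r : ℝ} (hn : n ≠ 0)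
    (hm : 0 < m ∨ m < -1) (hr : 2 ≤ r) (h1 : r ≤ |(|(n : ℝ)| - |(m : ℝ)|)|)
    (h2 : r ≤ |(|(n : ℝ)| - |(m + 1 : ℝ)|)|) (hrn : r ≤ |(n : ℝ)|) :
    ∃ S D : ℝ, 0 < S ∧ 0 < D ∧ S ≤ |(n : ℝ)| ∧
      S ≤ |spectralValue k m + spectralValue k n - 1| ∧
      S ≤ |spectralValue k m + spectralValue k n| ∧
      D ≤ |spectralValue k m - spectralValue k n - τ / 2| ∧
      D ≤ |spectralValue k m + 1 - spectralValue k n - τ / 2| ∧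
      |(n : ℝ)| / (S ^ 2 * D) + |(n : ℝ)| / (S * D ^ 2) ≤ 6 / r ^ 2 := by
  set N := |(n : ℝ)| with hN
  have hN0 : 0 < N := by linarith
  have hr0 : 0 < r := by linarith
  have hτ' := abs_le.mp hτ.le
  have ht : |τ / 2| ≤ 1 := by rw [abs_div, hτ]; norm_num
  have hsame : N / (N ^ 2 * (r / 2)) + N / (N * (r / 2) ^ 2) ≤ 6 / r ^ 2 := by
    have e : N / (N ^ 2 * (r / 2)) + N / (N * (r / 2) ^ 2) = 2 / (r * N) + 4 / r ^ 2 := by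
      field_simp; ring
    have : 2 / (r * N) ≤ 2 / r ^ 2 := by gcongr; nlinarith
    rw [e]
    have e2 : 6 / r ^ 2 = 2 / r ^ 2 + 4 / r ^ 2 := by ring
    linarith
  have hopp : N / ((r / 2) ^ 2 * N) + N / ((r / 2) * N ^ 2) ≤ 6 / r ^ 2 := by
    rw [add_comm, mul_comm (r / 2), mul_comm _ N]; exact hsame
  rcases hm with hm | hm
  · have hm1 : (1 : ℝ) ≤ m := by exact_mod_cast hm
    rw [abs_of_pos (by linarith : (0 : ℝ) < m)] at h1
    rw [abs_of_pos (by linarith : (0 : ℝ) < m + 1)] at h2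
    have em : spectralValue k m = m + k := by simp [spectralValue, hm]
    rcases lt_or_gt_of_ne hn with hn' | hn'
    · have hn1 : (n : ℝ) ≤ -1 := by exact_mod_cast (by omega : n ≤ -1)
      have en : spectralValue k n = n - k := by simp [spectralValue, hn'.le]
      have hNn : N = -n := abs_of_neg (by linarith)
      have d1 := le_abs_sub_of_le_abs hr h1 (t := -1) (by norm_num)
      refine ⟨r / 2, N, by positivity, hN0, by linarith, ?_, ?_, ?_, ?_, hopp⟩ <;> rw [em, en]
      · rw [← abs_neg]; convert d1 using 2; rw [hNn]; ring
      · rw [← abs_neg]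
        refine le_trans (by linarith) (h1.trans (le_of_eq ?_))
        congr 1; rw [hNn]; ring
      · exact le_abs.mpr (Or.inl (by linarith))
      · exact le_abs.mpr (Or.inl (by linarith))
    · have hn1 : (1 : ℝ) ≤ n := by exact_mod_cast hn'
      have en : spectralValue k n = n + k := by simp [spectralValue, hn']
      have hNn : N = n := abs_of_pos (by linarith)
      rw [abs_sub_comm] at h1 h2
      refine ⟨N, r / 2, hN0, by positivity, le_rfl, ?_, ?_, ?_, ?_, hsame⟩ <;> rw [em, en]
      · exact le_abs.mpr (Or.inl (by linarith))
      · exact le_abs.mpr (Or.inl (by linarith))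
      · convert le_abs_sub_of_le_abs hr h1 ht using 3; rw [hNn]; ring
      · convert le_abs_sub_of_le_abs hr h2 ht using 3; rw [hNn]; ring
  · have hm1 : (m : ℝ) ≤ -2 := by exact_mod_cast (by omega : m ≤ -2)
    rw [abs_of_neg (by linarith : (m : ℝ) < 0)] at h1
    rw [abs_of_neg (by linarith : (m + 1 : ℝ) < 0)] at h2
    have em : spectralValue k m = m - k := by
      rw [spectralValue, if_neg (by omega)]
    rcases lt_or_gt_of_ne hn with hn' | hn'
    · have hn1 : (n : ℝ) ≤ -1 := by exact_mod_cast (by omega : n ≤ -1)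
      have en : spectralValue k n = n - k := by simp [spectralValue, hn'.le]
      have hNn : N = -n := abs_of_neg (by linarith)
      refine ⟨N, r / 2, hN0, by positivity, le_rfl, ?_, ?_, ?_, ?_, hsame⟩ <;> rw [em, en]
      · exact le_abs.mpr (Or.inr (by linarith))
      · exact le_abs.mpr (Or.inr (by linarith))
      · convert le_abs_sub_of_le_abs hr h1 ht using 3; rw [hNn]; ring
      · convert le_abs_sub_of_le_abs hr h2 ht using 3; rw [hNn]; ring
    · have hn1 : (1 : ℝ) ≤ n := by exact_mod_cast hn'
      have en : spectralValue k n = n + k := by simp [spectralValue, hn']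
      have hNn : N = n := abs_of_pos (by linarith)
      have d1 := le_abs_sub_of_le_abs hr h1 (t := 1) (by norm_num)
      refine ⟨r / 2, N, by positivity, hN0, by linarith, ?_, ?_, ?_, ?_, hopp⟩ <;> rw [em, en]
      · convert d1 using 2; rw [hNn]; ring
      · refine le_trans (by linarith) (h1.trans (le_of_eq ?_))
        congr 1; rw [hNn]; ring
      · exact le_abs.mpr (Or.inr (by linarith))
      · exact le_abs.mpr (Or.inr (by linarith))

/-- The estimate for neighbouring indices. If `r < 2`, then the sum of the eigenvalues may come
close to `1`, where the integration by parts is void; in this range the kernel is just bounded. -/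
theorem exists_halfKernel_succ_sub_le {k : ℝ} (hk : 0 ≤ k) :
    ∃ C, 0 < C ∧ ∀ (τ : ℝ) (n m : ℤ) (r : ℝ), |τ| = 1 → n ≠ 0 → (0 < m ∨ m < -1) →
      |(n : ℝ)| ≤ 2 * |(m : ℝ)| → 0 < r → r ≤ |(|(n : ℝ)| - |(m : ℝ)|)| →
      r ≤ |(|(n : ℝ)| - |(m + 1 : ℝ)|)| → r ≤ |(n : ℝ)| →
      |halfKernel k τ (m + 1) n - halfKernel k τ m n| ≤ C / r ^ 2 := by
  obtain ⟨C₀, hC₀, hb⟩ := exists_norm_circleFun_le hk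
  obtain ⟨C₁, hC₁, hd⟩ := exists_norm_circleFun_sub_le hk
  set M := C₀ ^ 2 + 2 * C₁ * C₀ with hM
  have hM0 : 0 < M := by positivity
  refine ⟨(64 + 7 * (5 + 117 * k + 40 * k ^ 2)) * M, by positivity, ?_⟩
  intro τ n m r hτ hn hm hnm hr h1 h2 hrn
  have hτ2 : τ ^ 2 = 1 := by rw [← sq_abs, hτ, one_pow]
  have hN1 : (1 : ℝ) ≤ |(n : ℝ)| := by exact_mod_cast Int.one_le_abs hn
  have hprod : ∀ (i j : ℤ) (x : ℝ), x ∈ Set.Icc 0 Real.pi →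
      ‖circleFun k i x‖ * ‖circleFun k j x‖ ≤ M := by
    intro i j x hx
    calc _ ≤ C₀ * C₀ := mul_le_mul (hb i x hx) (hb j x hx) (norm_nonneg _) hC₀.le
      _ ≤ M := by rw [hM]; nlinarith [mul_pos hC₁ hC₀]
  have hbound : PairBound (circleFun k m) (circleFun k (m + 1)) (circleFun k n) M
      |(n : ℝ)|⁻¹ := by
    refine ⟨hprod (m + 1) n, fun x hx => ?_⟩
    have hsn : 0 ≤ Real.sin (x / 2) :=
      Real.sin_nonneg_of_nonneg_of_le_pi (by linarith [hx.1]) (by linarith [hx.1, hx.2])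
    have hinv : 1 / |(m : ℝ)| ≤ 2 * |(n : ℝ)|⁻¹ := by
      rw [div_le_iff₀ (by linarith), mul_right_comm, ← div_eq_mul_inv, le_div_iff₀ (by linarith)]
      linarith
    calc _ ≤ (C₁ * (Real.sin (x / 2) + 1 / |(m : ℝ)|)) * C₀ :=
          mul_le_mul (hd m x hm hx) (hb n x hx) (norm_nonneg _) (by positivity)
      _ ≤ (C₁ * (2 * (Real.sin (x / 2) + |(n : ℝ)|⁻¹))) * C₀ := by gcongr; linarith
      _ = 2 * C₁ * C₀ * (Real.sin (x / 2) + |(n : ℝ)|⁻¹) := by ring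
      _ ≤ _ := by
          gcongr
          rw [hM]; nlinarith
  have hp2 : 0 ≤ (5 + 117 * k + 40 * k ^ 2) * M := by positivity
  rcases lt_or_ge r 2 with hr2 | hr2
  · have hone : ∀ i j : ℤ, |halfKernel k τ i j| ≤ 8 * M := by
      intro i j
      have := intervalIntegral.norm_integral_le_of_norm_le_const (a := 0) (b := Real.pi)
        (C := 2 * M) (f := kernelIntegrand τ (circleFun k i) (circleFun k j)) (fun x hx => ?_)
      · rw [Real.norm_eq_abs, sub_zero, abs_of_pos Real.pi_pos] at this
        refine this.trans ?_
        nlinarith [Real.pi_le_four]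
      · rw [Set.uIoc_of_le Real.pi_pos.le] at hx
        exact (abs_kernelIntegrand_le hτ2 _ _ _).trans
          (mul_le_mul_of_nonneg_left (hprod i j x ⟨hx.1.le, hx.2⟩) (by norm_num))
    calc _ ≤ 8 * M + 8 * M := (abs_sub _ _).trans (add_le_add (hone _ _) (hone _ _))
      _ ≤ _ := by
        rw [le_div_iff₀ (by positivity)]
        have : r ^ 2 ≤ 4 := by nlinarith
        nlinarith
  · obtain ⟨S, D, hS, hD, hSN, hS1, hS2, hD1, hD2, hfin⟩ := exists_gaps hk hτ hn hm hr2 h1 h2 hrn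
    have s1 : IsCircleSol k (spectralValue k m) (circleFun k m) := isHalfSol_circleFun hk m
    have s2 : IsCircleSol k (spectralValue k m + 1) (circleFun k (m + 1)) := by
      rw [← spectralValue_add_one k hm]; exact isHalfSol_circleFun hk (m + 1)
    have s3 : IsCircleSol k (spectralValue k n) (circleFun k n) := isHalfSol_circleFun hk n
    refine (hbound.integral_kernelIntegrand_sub_le hk hτ2 s1 s2 s3 hM0.le hN1 hS hSN hS1 hS2 hD
      hD1 hD2).trans ?_
    have h3 : 1 / |(n : ℝ)| ^ 2 ≤ 1 / r ^ 2 := by gcongr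
    calc _ ≤ (5 + 117 * k + 40 * k ^ 2) * M * (1 / r ^ 2 + 6 / r ^ 2) := by
          refine mul_le_mul_of_nonneg_left ?_ hp2
          linarith
      _ = 7 * ((5 + 117 * k + 40 * k ^ 2) * M) / r ^ 2 := by ring
      _ ≤ _ := by
          refine div_le_div_of_nonneg_right ?_ (by positivity)
          linarith

theorem abs_add_natCast_sub_le_of_forall_succ {f : ℤ → ℝ} {c : ℝ} {m : ℤ} (d : ℕ)
    (h : ∀ i, m ≤ i → i < m + d → |f (i + 1) - f i| ≤ c) : |f (m + d) - f m| ≤ c * d := by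
  induction d with
  | zero => simp
  | succ d ih =>
    have h1 := ih fun i hi hid => h i hi (by push_cast; omega)
    have h2 := h (m + d) (by omega) (by push_cast; omega)
    have e : m + ((d + 1 : ℕ) : ℤ) = m + d + 1 := by push_cast; ring
    rw [e]
    have := abs_add_le (f (m + d + 1) - f (m + d)) (f (m + d) - f m)
    rw [sub_add_sub_cancel] at this
    push_cast
    linarith

theorem abs_sub_le_of_forall_mem_Ico {f : ℤ → ℝ} {c : ℝ} {m l : ℤ}
    (h : ∀ i, min m l ≤ i → i < max m l → |f (i + 1) - f i| ≤ c) :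
    |f l - f m| ≤ c * |(l : ℝ) - m| := by
  wlog hml : m ≤ l generalizing m l
  · have := this (m := l) (l := m) (by rwa [min_comm, max_comm]) (by omega)
    rwa [abs_sub_comm, abs_sub_comm (l : ℝ)]
  · obtain ⟨d, rfl⟩ := Int.le.dest hml
    rw [min_eq_left hml, max_eq_right hml] at h
    refine (abs_add_natCast_sub_le_of_forall_succ d h).trans (le_of_eq ?_)
    push_cast
    rw [add_sub_cancel_left, Nat.abs_cast]

/-- The hypotheses keep every integer between `m` and `l` at distance at least `||n| - |m|| / 2`
from `±n`, on the same side of `0`, so that the estimates for neighbouring indices add up. -/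
theorem exists_halfKernel_sub_le {k : ℝ} (hk : 0 ≤ k) :
    ∃ C, 0 < C ∧ ∀ (τ : ℝ) (n m l : ℤ), |τ| = 1 →
      |(n : ℝ)| / 2 ≤ |(m : ℝ)| → |(m : ℝ)| ≤ 3 * |(n : ℝ)| / 2 → |(n : ℝ)| / 2 ≤ |(l : ℝ)| →
      2 * |(m : ℝ) - l| ≤ |(|(n : ℝ)| - |(m : ℝ)|)| →
      |halfKernel k τ l n - halfKernel k τ m n| ≤
        C * |(l : ℝ) - m| / (|(m : ℝ)| - |(n : ℝ)|) ^ 2 := by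
  obtain ⟨C, hC, h⟩ := exists_halfKernel_succ_sub_le hk
  refine ⟨4 * C, by positivity, ?_⟩
  intro τ n m l hτ hm1 hm2 hl1 hml
  rcases eq_or_ne l m with rfl | hne
  · simp
  have hdist : (1 : ℝ) ≤ |(m : ℝ) - l| := by
    exact_mod_cast Int.one_le_abs (sub_ne_zero.mpr hne.symm)
  set ρ := |(|(n : ℝ)| - |(m : ℝ)|)| with hρ
  have hρ2 : 2 ≤ ρ := by linarith
  have hρn : ρ ≤ |(n : ℝ)| / 2 := by
    rw [hρ, abs_le]
    constructor <;> linarith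
  have hn : n ≠ 0 := by
    rintro rfl
    simp at hρn
    linarith
  have hclose : |(m : ℝ) - l| ≤ |(m : ℝ)| / 2 := by linarith
  have key : ∀ i, min m l ≤ i → i < max m l →
      |halfKernel k τ (i + 1) n - halfKernel k τ i n| ≤ C / (ρ / 2) ^ 2 := by
    intro i hi1 hi2
    have hi3 : min (m : ℝ) l ≤ i := by exact_mod_cast hi1
    have hi4 : (i : ℝ) + 1 ≤ max (m : ℝ) l := by exact_mod_cast hi2
    have hd : ∀ j : ℝ, min (m : ℝ) l ≤ j → j ≤ max (m : ℝ) l →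
        ρ / 2 ≤ |(|(n : ℝ)| - |j|)| := by
      intro j hj1 hj2
      have hjm : |(m : ℝ) - j| ≤ |(m : ℝ) - l| := by
        rcases le_total (m : ℝ) l with hh | hh
        · rw [min_eq_left hh] at hj1
          rw [max_eq_right hh] at hj2
          rw [abs_sub_comm, abs_sub_comm _ (l : ℝ), abs_of_nonneg (by linarith),
            abs_of_nonneg (by linarith)]
          linarith
        · rw [min_eq_right hh] at hj1
          rw [max_eq_left hh] at hj2
          rw [abs_of_nonneg (by linarith), abs_of_nonneg (by linarith)]
          linarith
      have t1 := abs_sub_abs_le_abs_sub (|(n : ℝ)| - |(m : ℝ)|) (|(n : ℝ)| - |j|)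
      have t2 := abs_abs_sub_abs_le (m : ℝ) j
      rw [show |(n : ℝ)| - |(m : ℝ)| - (|(n : ℝ)| - |j|) = -(|(m : ℝ)| - |j|) by ring,
        abs_neg] at t1
      linarith
    have hsign : (0 < i ∨ i < -1) ∧ |(n : ℝ)| ≤ 2 * |(i : ℝ)| := by
      rcases lt_trichotomy (m : ℝ) 0 with hm | hm | hm
      · rw [abs_of_neg hm] at hclose hm1
        have hc := abs_le.mp hclose
        have hl : (l : ℝ) < 0 := by linarith
        rw [abs_of_neg hl] at hl1
        have hmax : max (m : ℝ) l ≤ -(|(n : ℝ)| / 2) := max_le (by linarith) (by linarith)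
        have hn1 : 0 < |(n : ℝ)| := by linarith
        have hi : (i : ℝ) < -1 := by linarith
        refine ⟨Or.inr (by exact_mod_cast hi), ?_⟩
        rw [abs_of_neg (by linarith : (i : ℝ) < 0)]
        linarith
      · rw [hm, abs_zero] at hm1
        linarith
      · rw [abs_of_pos hm] at hclose hm1
        have hc := abs_le.mp hclose
        have hl : 0 < (l : ℝ) := by linarith
        rw [abs_of_pos hl] at hl1
        have hmin : |(n : ℝ)| / 2 ≤ min (m : ℝ) l := le_min (by linarith) (by linarith)
        have hi : 0 < (i : ℝ) := by linarith
        refine ⟨Or.inl (by exact_mod_cast hi), ?_⟩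
        rw [abs_of_pos hi]
        linarith
    refine h τ n i (ρ / 2) hτ hn hsign.1 hsign.2 (by linarith)
      (hd i hi3 (by linarith)) ?_ (by linarith)
    exact hd (i + 1) (by linarith) hi4
  refine (abs_sub_le_of_forall_mem_Ico (f := fun j => halfKernel k τ j n) key).trans (le_of_eq ?_)
  rw [← sq_abs (|(m : ℝ)| - |(n : ℝ)|), abs_sub_comm (|(m : ℝ)|), ← hρ]
  field_simp
  ring

end

end HeckmanOpdam

theorem mainTheorem3 (k : ℝ≥0) :
    ∃ C : ℝ, 0 < C ∧ ∀ n m l : ℤ,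
      (|n| : ℝ) / 2 ≤ (|m| : ℝ) → (|m| : ℝ) ≤ 3 * (|n| : ℝ) / 2 →
      (|n| : ℝ) / 2 ≤ (|l| : ℝ) → (|l| : ℝ) ≤ 3 * (|n| : ℝ) / 2 →
      2 * (|m - l| : ℝ) ≤ |(|n| : ℝ) - (|m| : ℝ)| →
      ‖HeckmanOpdam.rieszKernel k n l - HeckmanOpdam.rieszKernel k n m‖
          ≤ C * (|l - m| : ℝ) / ((|m| : ℝ) - (|n| : ℝ)) ^ 2 ∧
      ‖HeckmanOpdam.rieszKernel k l n - HeckmanOpdam.rieszKernel k m n‖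
          ≤ C * (|l - m| : ℝ) / ((|m| : ℝ) - (|n| : ℝ)) ^ 2 := by
  obtain ⟨C, hC, h⟩ := HeckmanOpdam.exists_halfKernel_sub_le k.coe_nonneg
  refine ⟨C, hC, fun n m l hm1 hm2 hl1 _ hml => ?_⟩
  have hpi : ∀ a b : ℝ, ‖((1 / Real.pi * a : ℝ) : ℂ) - ((1 / Real.pi * b : ℝ) : ℂ)‖ ≤ |a - b| := by
    intro a b
    rw [← Complex.ofReal_sub, Complex.norm_real, Real.norm_eq_abs, ← mul_sub, abs_mul]
    refine mul_le_of_le_one_left (abs_nonneg _) ?_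
    rw [abs_of_pos (by positivity), div_le_one Real.pi_pos]
    linarith [Real.pi_gt_three]
  rw [HeckmanOpdam.rieszKernel_eq_halfKernel, HeckmanOpdam.rieszKernel_eq_halfKernel,
    HeckmanOpdam.rieszKernel_eq_halfKernel, HeckmanOpdam.rieszKernel_eq_halfKernel,
    HeckmanOpdam.halfKernel_swap _ l, HeckmanOpdam.halfKernel_swap _ m]
  exact ⟨(hpi _ _).trans (h 1 n m l (by norm_num) hm1 hm2 hl1 hml),
    (hpi _ _).trans (h (-1) n m l (by norm_num) hm1 hm2 hl1 hml)⟩
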